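/- Let $n$ be a natural number (for $n\le 1$ there are no generators and everything is trivial). For $1\le i,j\le n-1$ put $\langle i,i\rangle=1$, $\langle i+1,i\rangle=-1$, $\langle i,j\rangle=0$ otherwise, and $i\cdot j=\langle i,j\rangle+\langle j,i\rangle$. Let $U=U_{v,t}(sl_n)$ be the unital associative $\mathbb{Q}(v,t)$-algebra generated by $E_i,F_i,K_i^{\pm1},K_i'^{\pm1}$ $(1\le i<n)$ with the relations: all $K_i^{\pm1},K_j'^{\pm1}$ commute with each other, $K_i^{\pm1}K_i^{\mp1}=1=K_i'^{\pm1}K_i'^{\mp1}$; $$K_iE_jK_i^{-1}=v^{i\cdot j}t^{\langle i,j\rangle-\langle j,i\rangle}E_j,\quad K_i'E_jK_i'^{-1}=v^{-i\cdot j}t^{\langle i,j\rangle-\langle j,i\rangle}E_j,$$ $$K_iF_jK_i^{-1}=v^{-i\cdot j}t^{\langle j,i\rangle-\langle i,j\rangle}F_j,\quad K_i'F_jK_i'^{-1}=v^{i\cdot j}t^{\langle j,i\rangle-\langle i,j\rangle}F_j;$$ $$E_iF_j-F_jE_i=\delta_{ij}\frac{K_i-K_i'}{v-v^{-1}};\qquad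 [E_i,E_j]=[F_i,F_j]=0\ \text{ if } |i-j|>1;$$ $$E_i^2E_{i+1}-t(v+v^{-1})E_iE_{i+1}E_i+t^2E_{i+1}E_i^2=0,\quad E_iE_{i+1}^2-t(v+v^{-1})E_{i+1}E_iE_{i+1}+t^2E_{i+1}^2E_i=0,$$ $$F_i^2F_{i+1}-t^{-1}(v+v^{-1})F_iF_{i+1}F_i+t^{-2}F_{i+1}F_i^2=0,\quad F_iF_{i+1}^2-t^{-1}(v+v^{-1})F_{i+1}F_iF_{i+1}+t^{-2}F_{i+1}^2F_i=0.$$ It is a Hopf algebra with $\Delta(K_i^{\pm1})=K_i^{\pm1}\otimes K_i^{\pm1}$, $\Delta(K_i'^{\pm1})=K_i'^{\pm1}\otimes K_i'^{\pm1}$, $\Delta(E_i)=E_i\otimes1+K_i\otimes E_i$, $\Delta(F_i)=1\otimes F_i+F_i\otimes K_i'$, $\varepsilon(K_i^{\pm1})=\varepsilon(K_i'^{\pm1})=1$, $\varepsilon(E_i)=\varepsilon(F_i)=0$, $S(K_i^{\pm1})=K_i^{\mp1}$, $S(K_i'^{\pm1})=K_i'^{\mp1}$, $S(E_i)=-K_i^{-1}E_i$,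 $S(F_i)=-F_iK_i'^{-1}$. Let $\mathcal B$ (resp. $\mathcal B'$) be the Hopf subalgebra of $U$ generated by the $E_i,K_i^{\pm1}$ (resp. $F_i,K_i'^{\pm1}$), and let $\mathcal B'^{coop}$ be the algebra $\mathcal B'$ with the opposite comultiplication and the antipode $S^{-1}$. A Hopf pairing of Hopf algebras $H'$ and $H$ over a field $k$ is a bilinear form $(-,-):H'\times H\to k$ with $(1,h)=\varepsilon(h)$, $(h',1)=\varepsilon(h')$, $(h',hl)=\sum(h'_{(1)},h)(h'_{(2)},l)$ and $(h'l',h)=\sum(h',h_{(1)})(l',h_{(2)})$ for all $h,l\in H$ and $h',l'\in H'$. Then there is a unique Hopf pairing $(-,-):\mathcal B'^{coop}\times\mathcal B\to\mathbb{Q}(v,t)$ such that, for all $1\le i,j<n$, $$(F_i,E_j)=\frac{\delta_{ij}}{v^{-1}-v},\qquad (K_i',K_j)=v^{j\cdot i}t^{\langle j,i\rangle-\langle i,j\rangle},\qquad (F_i,K_j^{\pm1})=0=(K_i'^{\pm1},E_j).$$ Moreover, $(S(a),S(b))=(a,b)$ for all $a\in\mathcal B'$ (the underlying space of $\mathcal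 B'^{coop}$) and $b\in\mathcal B$, where $S$ is the antipode of $U$. -/

import Mathlib

open scoped TensorProduct

noncomputable section

namespace TwoParameterQuantum

section General

variable {k : Type*} [Field k]

/-- The pairing `(h' ⊗ k', h ⊗ l) = (h', h) (k', l)` induced on tensor squares by a bilinear form. -/
def tensorPairing {H' H : Type*} [AddCommMonoid H'] [Module k H'] [AddCommMonoid H] [Module k H]
    (φ : H' →ₗ[k] H →ₗ[k] k) : H' ⊗[k] H' →ₗ[k] H ⊗[k] H →ₗ[k] k :=
  (TensorProduct.map₂ φ φ).compr₂ (LinearMap.mul' k k)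

theorem tensorPairing_tmul {H' H : Type*} [AddCommMonoid H'] [Module k H'] [AddCommMonoid H]
    [Module k H] (φ : H' →ₗ[k] H →ₗ[k] k) (a b : H') (c d : H) :
    tensorPairing φ (a ⊗ₜ b) (c ⊗ₜ d) = φ a c * φ b d := by
  simp [tensorPairing]

/-- Hopf pairings of two Hopf algebras `H'` and `H` over a field. -/
structure IsHopfPairing {H' H : Type*} [Semiring H'] [HopfAlgebra k H'] [Semiring H]
    [HopfAlgebra k H] (φ : H' →ₗ[k] H →ₗ[k] k) : Prop where
  one_left : ∀ h : H, φ 1 h = Coalgebra.counit h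
  one_right : ∀ h' : H', φ h' 1 = Coalgebra.counit h'
  mul_right : ∀ (h' : H') (h l : H),
    φ h' (h * l) = tensorPairing φ (Coalgebra.comul h') (h ⊗ₜ l)
  mul_left : ∀ (h' l' : H') (h : H),
    φ (h' * l') h = tensorPairing φ (h' ⊗ₜ l') (Coalgebra.comul h)

/-- The underlying algebra of `H^coop`: the algebra `H` itself. -/
def Coop (H : Type*) : Type _ := H

instance Coop.instRing (H : Type*) [Ring H] : Ring (Coop H) := inferInstanceAs (Ring H)

instance Coop.instAlgebra (H : Type*) [Ring H] [Algebra k H] : Algebra k (Coop H) :=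
  inferInstanceAs (Algebra k H)

/-- The identity map, from `H` to `H^coop`. -/
def toCoop (k : Type*) [Field k] {H : Type*} [Ring H] [Algebra k H] : H ≃ₐ[k] Coop H :=
  (AlgEquiv.refl : H ≃ₐ[k] H)

/-- The opposite comultiplication. -/
def comulOp (k : Type*) [Field k] (H : Type*) [Ring H] [Bialgebra k H] : H →ₐ[k] H ⊗[k] H :=
  (Algebra.TensorProduct.comm k H H).toAlgHom.comp (Bialgebra.comulAlgHom k H)

theorem comulOp_apply {H : Type*} [Ring H] [Bialgebra k H] (a : H) :
    comulOp k H a = TensorProduct.comm k H H (Coalgebra.comul a) := rfl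

/-- `H` with the opposite comultiplication, as a bialgebra structure on the algebra `H`. -/
abbrev bialgebraOp (k : Type*) [Field k] (H : Type*) [Ring H] [Bialgebra k H] : Bialgebra k H :=
  Bialgebra.ofAlgHom (comulOp k H) (Bialgebra.counitAlgHom k H)
    (by
      have key (D : H →ₗ[k] H ⊗[k] H) (z : H ⊗[k] H) :
          TensorProduct.assoc k H H H
            (((TensorProduct.comm k H H).toLinearMap ∘ₗ D).rTensor H
              (TensorProduct.comm k H H z)) =
          TensorProduct.assoc k H H H (TensorProduct.comm k H (H ⊗[k] H)
            ((TensorProduct.comm k H H).toLinearMap.lTensor H (D.lTensor H z))) := by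
        induction z with
        | zero => simp
        | add x y hx hy => simp only [map_add, hx, hy]
        | tmul a b => simp
      have key2 (D : H →ₗ[k] H ⊗[k] H) (z : H ⊗[k] H) :
          ((TensorProduct.comm k H H).toLinearMap ∘ₗ D).lTensor H
              (TensorProduct.comm k H H z) =
          TensorProduct.assoc k H H H (TensorProduct.comm k H (H ⊗[k] H)
            ((TensorProduct.comm k H H).toLinearMap.lTensor H
              (TensorProduct.assoc k H H H (D.rTensor H z)))) := by
        induction z with
        | zero => simp
        | add x y hx hy => simp only [map_add, hx, hy]
        | tmul a b =>
          simp only [LinearMap.rTensor_tmul, TensorProduct.comm_tmul, LinearMap.lTensor_tmul,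
            LinearMap.comp_apply]
          generalize D a = w
          induction w with
          | zero => simp
          | add x y hx hy => simp only [map_add, TensorProduct.tmul_add, TensorProduct.add_tmul,
              hx, hy]
          | tmul c d => simp
      ext a
      have h1 := key Coalgebra.comul (Coalgebra.comul a)
      have h2 := key2 Coalgebra.comul (Coalgebra.comul a)
      rw [Coalgebra.coassoc_apply] at h2
      exact h1.trans h2.symm)
    (by
      ext a
      have key (e : H →ₗ[k] k) (z : H ⊗[k] H) :
          e.rTensor H (TensorProduct.comm k H H z) =
            TensorProduct.comm k H k (e.lTensor H z) := by
        induction z with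
        | zero => simp
        | add x y hx hy => simp only [map_add, hx, hy]
        | tmul a b => simp
      have h1 := key Coalgebra.counit (Coalgebra.comul a)
      rw [Coalgebra.lTensor_counit_comul] at h1
      exact h1)
    (by
      ext a
      have key (e : H →ₗ[k] k) (z : H ⊗[k] H) :
          e.lTensor H (TensorProduct.comm k H H z) =
            TensorProduct.comm k k H (e.rTensor H z) := by
        induction z with
        | zero => simp
        | add x y hx hy => simp only [map_add, hx, hy]
        | tmul a b => simp
      have h1 := key Coalgebra.counit (Coalgebra.comul a)
      rw [Coalgebra.rTensor_counit_comul] at h1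
      exact h1)

/-- If the antipode `S` of `H` is bijective, then `H` with the opposite comultiplication is
a Hopf algebra with antipode `S⁻¹`. -/
abbrev hopfAlgebraOp (k : Type*) [Field k] (H : Type*) [Ring H] [HopfAlgebra k H]
    (hS : Function.Bijective (HopfAlgebra.antipode k : H →ₗ[k] H)) : HopfAlgebra k H :=
  let T : H →ₗ[k] H := (LinearEquiv.ofBijective (HopfAlgebra.antipode k) hS).symm
  { bialgebraOp k H with
    antipode := T
    mul_antipode_rTensor_comul := by
      have hT (x : H) : HopfAlgebra.antipode k (T x) = x :=
        (LinearEquiv.ofBijective (HopfAlgebra.antipode k) hS).apply_symm_apply x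
      have key (z : H ⊗[k] H) : HopfAlgebra.antipode k (LinearMap.mul' k H
          (T.rTensor H (TensorProduct.comm k H H z))) =
          LinearMap.mul' k H ((HopfAlgebra.antipode k).rTensor H z) := by
        induction z with
        | zero => simp
        | add x y hx hy => simp only [map_add, hx, hy]
        | tmul a b => simp [HopfAlgebra.antipode_mul_antidistrib, hT]
      ext a
      apply hS.1
      have h := key (Coalgebra.comul a)
      rw [HopfAlgebra.mul_antipode_rTensor_comul_apply] at h
      refine h.trans ?_
      change _ = HopfAlgebra.antipode k (algebraMap k H (Coalgebra.counit a))
      simp [Algebra.algebraMap_eq_smul_one]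
    mul_antipode_lTensor_comul := by
      have hT (x : H) : HopfAlgebra.antipode k (T x) = x :=
        (LinearEquiv.ofBijective (HopfAlgebra.antipode k) hS).apply_symm_apply x
      have key (z : H ⊗[k] H) : HopfAlgebra.antipode k (LinearMap.mul' k H
          (T.lTensor H (TensorProduct.comm k H H z))) =
          LinearMap.mul' k H ((HopfAlgebra.antipode k).lTensor H z) := by
        induction z with
        | zero => simp
        | add x y hx hy => simp only [map_add, hx, hy]
        | tmul a b => simp [HopfAlgebra.antipode_mul_antidistrib, hT]
      ext a
      apply hS.1
      have h := key (Coalgebra.comul a)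
      rw [HopfAlgebra.mul_antipode_lTensor_comul_apply] at h
      refine h.trans ?_
      change _ = HopfAlgebra.antipode k (algebraMap k H (Coalgebra.counit a))
      simp [Algebra.algebraMap_eq_smul_one] }

/-- An algebra `A` embedded in a bialgebra `H` by `j`, with a map `D` that `j` intertwines
with the comultiplication of `H`, is a bialgebra. -/
abbrev bialgebraOfInjective {H A : Type*} [Ring H] [Bialgebra k H] [Ring A] [Algebra k A]
    (j : A →ₐ[k] H) (hj : Function.Injective j) (D : A →ₐ[k] A ⊗[k] A)
    (hD : ∀ a, Algebra.TensorProduct.map j j (D a) = Coalgebra.comul (j a)) : Bialgebra k A :=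
  Bialgebra.ofAlgHom D ((Bialgebra.counitAlgHom k H).comp j)
    (by
      have inj3 : Function.Injective
          (Algebra.TensorProduct.map j (Algebra.TensorProduct.map j j)) :=
        TensorProduct.map_injective_of_flat_flat j.toLinearMap
          (Algebra.TensorProduct.map j j).toLinearMap hj
          (TensorProduct.map_injective_of_flat_flat j.toLinearMap j.toLinearMap hj hj)
      have h1 (z : A ⊗[k] A) : Algebra.TensorProduct.map j (Algebra.TensorProduct.map j j)
          (TensorProduct.assoc k A A A (D.toLinearMap.rTensor A z)) =
          TensorProduct.assoc k H H H
            (Coalgebra.comul.rTensor H (Algebra.TensorProduct.map j j z)) := by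
        induction z with
        | zero => simp
        | add x y hx hy => simp only [map_add, hx, hy]
        | tmul a b =>
          simp only [LinearMap.rTensor_tmul, AlgHom.toLinearMap_apply,
            Algebra.TensorProduct.map_tmul, ← hD a]
          generalize D a = w
          induction w with
          | zero => simp
          | add x y hx hy => simp only [map_add, TensorProduct.add_tmul, hx, hy]
          | tmul c d => simp
      have h2 (z : A ⊗[k] A) : Algebra.TensorProduct.map j (Algebra.TensorProduct.map j j)
          (D.toLinearMap.lTensor A z) =
          Coalgebra.comul.lTensor H (Algebra.TensorProduct.map j j z) := by
        induction z with
        | zero => simp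
        | add x y hx hy => simp only [map_add, hx, hy]
        | tmul a b =>
          simp only [LinearMap.lTensor_tmul, AlgHom.toLinearMap_apply,
            Algebra.TensorProduct.map_tmul, ← hD b]
      ext b
      apply inj3
      refine (h1 (D b)).trans (Eq.trans ?_ (h2 (D b)).symm)
      rw [hD, Coalgebra.coassoc_apply])
    (by
      have inj : Function.Injective (LinearMap.lTensor k j.toLinearMap) :=
        Module.Flat.lTensor_preserves_injective_linearMap _ hj
      have h1 (z : A ⊗[k] A) : LinearMap.lTensor k j.toLinearMap
          ((Coalgebra.counit ∘ₗ j.toLinearMap).rTensor A z) =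
          Coalgebra.counit.rTensor H (Algebra.TensorProduct.map j j z) := by
        induction z with
        | zero => simp
        | add x y hx hy => simp only [map_add, hx, hy]
        | tmul a b => simp
      ext b
      apply inj
      refine (h1 (D b)).trans ?_
      rw [hD, Coalgebra.rTensor_counit_comul]
      rfl)
    (by
      have inj : Function.Injective (LinearMap.rTensor k j.toLinearMap) :=
        Module.Flat.rTensor_preserves_injective_linearMap _ hj
      have h1 (z : A ⊗[k] A) : LinearMap.rTensor k j.toLinearMap
          ((Coalgebra.counit ∘ₗ j.toLinearMap).lTensor A z) =
          Coalgebra.counit.lTensor H (Algebra.TensorProduct.map j j z) := by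
        induction z with
        | zero => simp
        | add x y hx hy => simp only [map_add, hx, hy]
        | tmul a b => simp
      ext b
      apply inj
      refine (h1 (D b)).trans ?_
      rw [hD, Coalgebra.lTensor_counit_comul]
      rfl)

theorem mul_rTensor_of_injective {H A : Type*} [Ring H] [HopfAlgebra k H] [Ring A] [Algebra k A]
    (j : A →ₐ[k] H) (hj : Function.Injective j) (D : A →ₐ[k] A ⊗[k] A) (T : A →ₗ[k] A)
    (hD : ∀ a, Algebra.TensorProduct.map j j (D a) = Coalgebra.comul (j a))
    (hT : ∀ a, j (T a) = HopfAlgebra.antipode k (j a)) :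
    LinearMap.mul' k A ∘ₗ T.rTensor A ∘ₗ D.toLinearMap =
      Algebra.linearMap k A ∘ₗ Coalgebra.counit ∘ₗ j.toLinearMap := by
  have h1 (z : A ⊗[k] A) : j (LinearMap.mul' k A (T.rTensor A z))
      = LinearMap.mul' k H
        ((HopfAlgebra.antipode k).rTensor H (Algebra.TensorProduct.map j j z)) := by
    induction z with
    | zero => simp
    | add x y hx hy => simp only [map_add, hx, hy]
    | tmul a b => simp [hT]
  ext b
  apply hj
  refine (h1 (D b)).trans ?_
  rw [hD, HopfAlgebra.mul_antipode_rTensor_comul_apply]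
  exact (j.commutes _).symm

theorem mul_lTensor_of_injective {H A : Type*} [Ring H] [HopfAlgebra k H] [Ring A] [Algebra k A]
    (j : A →ₐ[k] H) (hj : Function.Injective j) (D : A →ₐ[k] A ⊗[k] A) (T : A →ₗ[k] A)
    (hD : ∀ a, Algebra.TensorProduct.map j j (D a) = Coalgebra.comul (j a))
    (hT : ∀ a, j (T a) = HopfAlgebra.antipode k (j a)) :
    LinearMap.mul' k A ∘ₗ T.lTensor A ∘ₗ D.toLinearMap =
      Algebra.linearMap k A ∘ₗ Coalgebra.counit ∘ₗ j.toLinearMap := by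
  have h1 (z : A ⊗[k] A) : j (LinearMap.mul' k A (T.lTensor A z))
      = LinearMap.mul' k H
        ((HopfAlgebra.antipode k).lTensor H (Algebra.TensorProduct.map j j z)) := by
    induction z with
    | zero => simp
    | add x y hx hy => simp only [map_add, hx, hy]
    | tmul a b => simp [hT]
  ext b
  apply hj
  refine (h1 (D b)).trans ?_
  rw [hD, HopfAlgebra.mul_antipode_lTensor_comul_apply]
  exact (j.commutes _).symm

/-- An algebra `A` embedded in a Hopf algebra `H` by `j`, with maps `D`, `T` that `j` intertwines
with the comultiplication and the antipode of `H`, is a Hopf algebra. -/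
abbrev hopfOfInjective {H A : Type*} [Ring H] [HopfAlgebra k H] [Ring A] [Algebra k A]
    (j : A →ₐ[k] H) (hj : Function.Injective j) (D : A →ₐ[k] A ⊗[k] A) (T : A →ₗ[k] A)
    (hD : ∀ a, Algebra.TensorProduct.map j j (D a) = Coalgebra.comul (j a))
    (hT : ∀ a, j (T a) = HopfAlgebra.antipode k (j a)) : HopfAlgebra k A :=
  { bialgebraOfInjective j hj D hD with
    antipode := T
    mul_antipode_rTensor_comul := mul_rTensor_of_injective j hj D T hD hT
    mul_antipode_lTensor_comul := mul_lTensor_of_injective j hj D T hD hT }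

/-- `H^coop` for a Hopf algebra `H` with bijective antipode `S`: the algebra `H` with the opposite
comultiplication and the antipode `S⁻¹`. -/
abbrev coopHopf (k : Type*) [Field k] (H : Type*) [Ring H] [HopfAlgebra k H]
    (hS : Function.Bijective (HopfAlgebra.antipode k : H →ₗ[k] H)) : HopfAlgebra k (Coop H) :=
  @hopfOfInjective k _ H (Coop H) _ (hopfAlgebraOp k H hS) _ _ (toCoop k (H := H)).symm.toAlgHom
    (toCoop k (H := H)).symm.injective
    ((Algebra.TensorProduct.map (toCoop k (H := H)).toAlgHom (toCoop k (H := H)).toAlgHom).comp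
      ((comulOp k H).comp (toCoop k (H := H)).symm.toAlgHom))
    ((toCoop k (H := H)).toLinearMap ∘ₗ
      (LinearEquiv.ofBijective (HopfAlgebra.antipode k) hS).symm.toLinearMap ∘ₗ
      (toCoop k (H := H)).symm.toLinearMap)
    (fun a => by
      have key (z : H ⊗[k] H) : Algebra.TensorProduct.map (toCoop k (H := H)).symm.toAlgHom
          (toCoop k (H := H)).symm.toAlgHom (Algebra.TensorProduct.map
            (toCoop k (H := H)).toAlgHom (toCoop k (H := H)).toAlgHom z) = z := by
        induction z with
        | zero => simp
        | add x y hx hy => simp only [map_add, hx, hy]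
        | tmul a b => simp
      exact key _)
    (fun _ => rfl)

variable {H : Type*} [Ring H] [HopfAlgebra k H] (B : Subalgebra k H)

/-- The map `B ⊗ B → H ⊗ H` for a subalgebra `B` of `H`. -/
abbrev tensorIncl : B ⊗[k] B →ₐ[k] H ⊗[k] H := Algebra.TensorProduct.map B.val B.val

/-- The conditions `Δ(B) ⊆ B ⊗ B` and `S(B) ⊆ B` for a subalgebra `B` to be a Hopf subalgebra. -/
structure IsHopfSubalgebra : Prop where
  comul_mem : ∀ b ∈ B, (Coalgebra.comul b : H ⊗[k] H) ∈ (tensorIncl B).range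
  antipode_mem : ∀ b ∈ B, HopfAlgebra.antipode k b ∈ B

variable {B}

theorem tensorIncl_injective : Function.Injective (tensorIncl B) :=
  TensorProduct.map_injective_of_flat_flat B.val.toLinearMap B.val.toLinearMap
    Subtype.val_injective Subtype.val_injective

/-- The restriction of the comultiplication of `H` to a Hopf subalgebra `B`. -/
def subComul (hB : IsHopfSubalgebra B) : B →ₐ[k] B ⊗[k] B :=
  (AlgEquiv.ofInjective (tensorIncl B) tensorIncl_injective).symm.toAlgHom.comp
    (((Bialgebra.comulAlgHom k H).comp B.val).codRestrict (tensorIncl B).range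
      fun b => hB.comul_mem b b.2)

theorem tensorIncl_subComul (hB : IsHopfSubalgebra B) (b : B) :
    tensorIncl B (subComul hB b) = Coalgebra.comul (b : H) := by
  have h := (AlgEquiv.ofInjective (tensorIncl B) tensorIncl_injective).apply_symm_apply
    ((((Bialgebra.comulAlgHom k H).comp B.val).codRestrict (tensorIncl B).range
      fun b => hB.comul_mem b b.2) b)
  exact congrArg Subtype.val h

/-- The restriction of the antipode of `H` to a Hopf subalgebra `B`. -/
def subAntipode (hB : IsHopfSubalgebra B) : B →ₗ[k] B where
  toFun b := ⟨HopfAlgebra.antipode k (b : H), hB.antipode_mem b b.2⟩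
  map_add' _ _ := Subtype.ext (by simp)
  map_smul' _ _ := Subtype.ext (by simp)

/-- The Hopf algebra structure of a Hopf subalgebra. -/
abbrev subHopf (hB : IsHopfSubalgebra B) : HopfAlgebra k B :=
  hopfOfInjective B.val Subtype.val_injective (subComul hB) (subAntipode hB)
    (tensorIncl_subComul hB) (fun _ => rfl)

end General

section QuantumGroup

/-- The matrix `Ω` of type `A`, of size `m`: `⟨i, i⟩ = 1`, `⟨i + 1, i⟩ = -1`, and `0` elsewhere.
The index `i : Fin m` stands for the vertex `i + 1` of `{1, …, m}`. -/
def Omega {m : ℕ} (i j : Fin m) : ℤ :=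
  if i = j then 1 else if (i : ℕ) = (j : ℕ) + 1 then -1 else 0

/-- The symmetric form `i · j = ⟨i, j⟩ + ⟨j, i⟩`. -/
def dotForm {m : ℕ} (i j : Fin m) : ℤ := Omega i j + Omega j i

/-- The symbols `E_i`, `F_i`, `K_i^{±1}`, `K'_i^{±1}`; the exponent is an element of `ℤˣ`. -/
inductive Gen (m : ℕ) : Type
  | E (i : Fin m) : Gen m
  | F (i : Fin m) : Gen m
  | K (e : ℤˣ) (i : Fin m) : Gen m
  | K' (e : ℤˣ) (i : Fin m) : Gen m

open Gen

variable {k : Type*} [Field k] (v t : kˣ) {m : ℕ}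

/-- The defining relations, for a family `x` of elements of an algebra indexed by the symbols. -/
inductive Rel {A : Type*} [Ring A] [Algebra k A] (x : Gen m → A) : A → A → Prop
  | KK (e e' : ℤˣ) (i j : Fin m) : Rel x (x (K e i) * x (K e' j)) (x (K e' j) * x (K e i))
  | K'K' (e e' : ℤˣ) (i j : Fin m) : Rel x (x (K' e i) * x (K' e' j)) (x (K' e' j) * x (K' e i))
  | KK' (e e' : ℤˣ) (i j : Fin m) : Rel x (x (K e i) * x (K' e' j)) (x (K' e' j) * x (K e i))
  | K_inv (e : ℤˣ) (i : Fin m) : Rel x (x (K e i) * x (K (-e) i)) 1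
  | K'_inv (e : ℤˣ) (i : Fin m) : Rel x (x (K' e i) * x (K' (-e) i)) 1
  | KE (i j : Fin m) : Rel x (x (K 1 i) * x (E j) * x (K (-1) i))
      (((v ^ dotForm i j * t ^ (Omega i j - Omega j i) : kˣ) : k) • x (E j))
  | K'E (i j : Fin m) : Rel x (x (K' 1 i) * x (E j) * x (K' (-1) i))
      (((v ^ (-dotForm i j) * t ^ (Omega i j - Omega j i) : kˣ) : k) • x (E j))
  | KF (i j : Fin m) : Rel x (x (K 1 i) * x (F j) * x (K (-1) i))
      (((v ^ (-dotForm i j) * t ^ (Omega j i - Omega i j) : kˣ) : k) • x (F j))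
  | K'F (i j : Fin m) : Rel x (x (K' 1 i) * x (F j) * x (K' (-1) i))
      (((v ^ dotForm i j * t ^ (Omega j i - Omega i j) : kˣ) : k) • x (F j))
  | EF (i j : Fin m) : Rel x (x (E i) * x (F j) - x (F j) * x (E i))
      ((if i = j then ((v : k) - (v : k)⁻¹)⁻¹ else 0) • (x (K 1 i) - x (K' 1 i)))
  | EE (i j : Fin m) (h : 1 < |(i : ℤ) - (j : ℤ)|) : Rel x (x (E i) * x (E j)) (x (E j) * x (E i))
  | FF (i j : Fin m) (h : 1 < |(i : ℤ) - (j : ℤ)|) : Rel x (x (F i) * x (F j)) (x (F j) * x (F i))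
  | serreE (i j : Fin m) (h : (j : ℕ) = (i : ℕ) + 1) :
      Rel x (x (E i) ^ 2 * x (E j) - ((t : k) * ((v : k) + (v : k)⁻¹)) • (x (E i) * x (E j) * x (E i))
        + ((t : k) ^ 2) • (x (E j) * x (E i) ^ 2)) 0
  | serreE' (i j : Fin m) (h : (j : ℕ) = (i : ℕ) + 1) :
      Rel x (x (E i) * x (E j) ^ 2 - ((t : k) * ((v : k) + (v : k)⁻¹)) • (x (E j) * x (E i) * x (E j))
        + ((t : k) ^ 2) • (x (E j) ^ 2 * x (E i))) 0
  | serreF (i j : Fin m) (h : (j : ℕ) = (i : ℕ) + 1) :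
      Rel x (x (F i) ^ 2 * x (F j)
        - ((t : k)⁻¹ * ((v : k) + (v : k)⁻¹)) • (x (F i) * x (F j) * x (F i))
        + ((t : k)⁻¹ ^ 2) • (x (F j) * x (F i) ^ 2)) 0
  | serreF' (i j : Fin m) (h : (j : ℕ) = (i : ℕ) + 1) :
      Rel x (x (F i) * x (F j) ^ 2
        - ((t : k)⁻¹ * ((v : k) + (v : k)⁻¹)) • (x (F j) * x (F i) * x (F j))
        + ((t : k)⁻¹ ^ 2) • (x (F j) ^ 2 * x (F i))) 0

/-- The algebra `U_{v,t}(sl_n)` over `k`: generated by the symbols, subject to the relations,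
for `n = m + 1`. -/
def U (v t : kˣ) (m : ℕ) : Type _ :=
  RingQuot (Rel v t (FreeAlgebra.ι k : Gen m → FreeAlgebra k (Gen m)))

instance U.instRing (v t : kˣ) (m : ℕ) : Ring (U v t m) :=
  inferInstanceAs (Ring (RingQuot (Rel v t (FreeAlgebra.ι k : Gen m → FreeAlgebra k (Gen m)))))

instance U.instAlgebra (v t : kˣ) (m : ℕ) : Algebra k (U v t m) :=
  inferInstanceAs (Algebra k (RingQuot (Rel v t (FreeAlgebra.ι k : Gen m → FreeAlgebra k (Gen m)))))

/-- The projection of the free algebra onto `U`. -/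
def U.mk : FreeAlgebra k (Gen m) →ₐ[k] U v t m :=
  RingQuot.mkAlgHom k (Rel v t (FreeAlgebra.ι k : Gen m → FreeAlgebra k (Gen m)))

/-- The generators of `U`. -/
def U.gen (g : Gen m) : U v t m := U.mk v t (FreeAlgebra.ι k g)

variable {v t}

theorem Rel.map {A C : Type*} [Ring A] [Algebra k A] [Ring C] [Algebra k C] (f : A →ₐ[k] C)
    {x : Gen m → A} {a b : A} (h : Rel v t x a b) : Rel v t (fun g => f (x g)) (f a) (f b) := by
  cases h <;> simp only [map_mul, map_smul, map_sub, map_add, map_pow, map_one, map_zero] <;>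
    (constructor <;> assumption)

theorem U.rel {a b : U v t m} (h : Rel v t (U.gen v t) a b) : a = b := by
  cases h <;> simp only [U.gen, ← map_mul, ← map_smul, ← map_sub, ← map_add, ← map_pow] <;>
    first
    | (rw [← map_one (U.mk v t)]; apply RingQuot.mkAlgHom_rel; constructor)
    | (rw [← map_zero (U.mk v t)]; apply RingQuot.mkAlgHom_rel; constructor; assumption)
    | (apply RingQuot.mkAlgHom_rel; constructor <;> assumption)

/-- The universal property of `U`. -/
def U.lift {A : Type*} [Ring A] [Algebra k A] (x : Gen m → A)
    (hx : ∀ a b, Rel v t x a b → a = b) : U v t m →ₐ[k] A :=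
  RingQuot.liftAlgHom k ⟨FreeAlgebra.lift k x, fun a b h => hx _ _ (by
    have := Rel.map (FreeAlgebra.lift k x) h
    simpa only [FreeAlgebra.lift_ι_apply] using this)⟩

@[simp]
theorem U.lift_gen {A : Type*} [Ring A] [Algebra k A] (x : Gen m → A)
    (hx : ∀ a b, Rel v t x a b → a = b) (g : Gen m) : U.lift x hx (U.gen v t g) = x g := by
  refine (RingQuot.liftAlgHom_mkAlgHom_apply k _ _ _).trans ?_
  simp

theorem U.hom_ext {A : Type*} [Ring A] [Algebra k A] {f f' : U v t m →ₐ[k] A}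
    (h : ∀ g, f (U.gen v t g) = f' (U.gen v t g)) : f = f' := by
  apply RingQuot.ringQuot_ext'
  ext g
  exact h g

theorem U.adjoin_gen : Algebra.adjoin k (Set.range (U.gen v t : Gen m → U v t m)) = ⊤ := by
  have h : (U.mk v t (m := m)).range = ⊤ :=
    (AlgHom.range_eq_top _).2 (RingQuot.mkAlgHom_surjective k _)
  rw [← h, ← Algebra.map_top, ← FreeAlgebra.adjoin_range_ι, AlgHom.map_adjoin, ← Set.range_comp]
  rfl

theorem U.induction {p : U v t m → Prop} (hgen : ∀ g, p (U.gen v t g))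
    (hk : ∀ r : k, p (algebraMap k _ r)) (hadd : ∀ x y, p x → p y → p (x + y))
    (hmul : ∀ x y, p x → p y → p (x * y)) (x : U v t m) : p x := by
  have hx : x ∈ Algebra.adjoin k (Set.range (U.gen v t : Gen m → U v t m)) := by
    rw [U.adjoin_gen]; trivial
  induction hx using Algebra.adjoin_induction with
  | mem x hx => obtain ⟨g, rfl⟩ := hx; exact hgen g
  | algebraMap r => exact hk r
  | add x y _ _ h h' => exact hadd x y h h'
  | mul x y _ _ h h' => exact hmul x y h h'

theorem conj_left {A : Type*} [Ring A] [Algebra k A] {a b x : A} {r : k} (hba : b * a = 1)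
    (h : a * x * b = r • x) : a * x = r • (x * a) := by
  rw [← smul_mul_assoc, ← h, mul_assoc _ b a, hba, mul_one]

theorem conj_right {A : Type*} [Ring A] [Algebra k A] {a b x : A} {r : k} (hba : b * a = 1)
    (h : a * x * b = r • x) : x * b = r • (b * x) := by
  rw [← mul_smul_comm, ← h, mul_assoc a, ← mul_assoc b, hba, one_mul]

/-- The left-hand side of a quantum Serre relation. -/
def serre {A : Type*} [Ring A] [Algebra k A] (v τ : kˣ) (a b : A) : A :=
  a ^ 2 * b - ((τ : k) * ((v : k) + (v : k)⁻¹)) • (a * b * a) + ((τ : k) ^ 2) • (b * a ^ 2)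

theorem serre_swap {A : Type*} [Ring A] [Algebra k A] (v τ : kˣ) (a b : A) :
    a * b ^ 2 - ((τ : k) * ((v : k) + (v : k)⁻¹)) • (b * a * b) + ((τ : k) ^ 2) • (b ^ 2 * a) =
      ((τ : k) ^ 2) • serre v τ⁻¹ b a := by
  have hv := v.ne_zero
  have hτ := τ.ne_zero
  simp only [serre, Units.val_inv_eq_inv_val]
  match_scalars <;> field_simp

theorem serre_add {A : Type*} [Ring A] [Algebra k A] {v τ : kˣ} {a b c d : A}
    (hca : c * a = ((v : k) ^ 2) • (a * c)) (hcb : c * b = ((v : k)⁻¹ * τ) • (b * c))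
    (hda : d * a = ((v : k)⁻¹ * (τ : k)⁻¹) • (a * d)) :
    serre v τ (a + c) (b + d) = serre v τ a b + serre v τ c d := by
  have hv := v.ne_zero
  have hτ := τ.ne_zero
  have hca' (z : A) : c * (a * z) = ((v : k) ^ 2) • (a * (c * z)) := by
    rw [← mul_assoc, hca, smul_mul_assoc, mul_assoc]
  have hcb' (z : A) : c * (b * z) = ((v : k)⁻¹ * τ) • (b * (c * z)) := by
    rw [← mul_assoc, hcb, smul_mul_assoc, mul_assoc]
  have hda' (z : A) : d * (a * z) = ((v : k)⁻¹ * (τ : k)⁻¹) • (a * (d * z)) := by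
    rw [← mul_assoc, hda, smul_mul_assoc, mul_assoc]
  simp only [serre, pow_two, mul_add, add_mul, mul_assoc, hca, hcb, hda, hca', hcb', hda',
    mul_smul_comm, smul_mul_assoc, smul_add, smul_smul]
  match_scalars <;> field_simp <;> ring

theorem serre_tmul {A C : Type*} [Ring A] [Algebra k A] [Ring C] [Algebra k C] {v τ : kˣ}
    {g h : A} (hgh : g * h = h * g) {a b : C} (hab : serre v τ a b = 0) :
    serre v τ (g ⊗ₜ[k] a) (h ⊗ₜ[k] b) = 0 := by
  have h1 : serre v τ (g ⊗ₜ[k] a) (h ⊗ₜ[k] b) = (g * g * h) ⊗ₜ[k] serre v τ a b := by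
    have e1 : g * h * g = g * g * h := by rw [mul_assoc, ← hgh, ← mul_assoc]
    have e2 : h * (g * g) = g * g * h := by rw [← mul_assoc, ← hgh, e1]
    simp only [serre, pow_two, Algebra.TensorProduct.tmul_mul_tmul, TensorProduct.tmul_add,
      TensorProduct.tmul_sub, TensorProduct.tmul_smul, e1, e2]
  rw [h1, hab, TensorProduct.tmul_zero]

theorem serre_tmul' {A C : Type*} [Ring A] [Algebra k A] [Ring C] [Algebra k C] {v τ : kˣ}
    {g h : C} (hgh : g * h = h * g) {a b : A} (hab : serre v τ a b = 0) :
    serre v τ (a ⊗ₜ[k] g) (b ⊗ₜ[k] h) = 0 := by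
  have h1 : serre v τ (a ⊗ₜ[k] g) (b ⊗ₜ[k] h) = serre v τ a b ⊗ₜ[k] (g * g * h) := by
    have e1 : g * h * g = g * g * h := by rw [mul_assoc, ← hgh, ← mul_assoc]
    have e2 : h * (g * g) = g * g * h := by rw [← mul_assoc, ← hgh, e1]
    simp only [serre, pow_two, Algebra.TensorProduct.tmul_mul_tmul, TensorProduct.add_tmul,
      TensorProduct.sub_tmul, TensorProduct.smul_tmul', e1, e2]
  rw [h1, hab, TensorProduct.zero_tmul]

/-- The behaviour of the Serre element under `a ↦ -g a`, `b ↦ -h b` in the opposite algebra. -/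
theorem serre_op {A : Type*} [Ring A] [Algebra k A] {v τ : kˣ} {a b g h : A} (hgh : g * h = h * g)
    (hag : a * g = ((v : k) ^ 2) • (g * a)) (hbg : b * g = ((v : k)⁻¹ * τ) • (g * b))
    (hah : a * h = ((v : k)⁻¹ * (τ : k)⁻¹) • (h * a)) (hab : serre v τ a b = 0) :
    serre v τ (MulOpposite.op (-(g * a))) (MulOpposite.op (-(h * b))) = 0 := by
  have hv := v.ne_zero
  have hτ := τ.ne_zero
  have hag' (z : A) : a * (g * z) = ((v : k) ^ 2) • (g * (a * z)) := by
    rw [← mul_assoc, hag, smul_mul_assoc, mul_assoc]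
  have hbg' (z : A) : b * (g * z) = ((v : k)⁻¹ * τ) • (g * (b * z)) := by
    rw [← mul_assoc, hbg, smul_mul_assoc, mul_assoc]
  have hah' (z : A) : a * (h * z) = ((v : k)⁻¹ * (τ : k)⁻¹) • (h * (a * z)) := by
    rw [← mul_assoc, hah, smul_mul_assoc, mul_assoc]
  have hgh' (z : A) : h * (g * z) = g * (h * z) := by
    rw [← mul_assoc, ← hgh, mul_assoc]
  have h1 : serre v τ (MulOpposite.op (-(g * a))) (MulOpposite.op (-(h * b))) =
      MulOpposite.op (-(g * (g * (h * serre v τ a b)))) := by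
    apply MulOpposite.unop_injective
    simp only [serre, pow_two, mul_add, mul_sub, mul_assoc, hag', hbg', hah', hgh', MulOpposite.unop_add,
      MulOpposite.unop_sub, MulOpposite.unop_smul, MulOpposite.unop_mul, MulOpposite.unop_op,
      mul_smul_comm, smul_mul_assoc, smul_smul, neg_mul, mul_neg, neg_neg]
    match_scalars <;> field_simp
  rw [h1, hab]
  simp

theorem serre_smul {A : Type*} [Ring A] [Algebra k A] {v τ : kˣ} (r s : k) {a b : A}
    (hab : serre v τ a b = 0) : serre v τ (r • a) (s • b) = 0 := by
  have h1 : serre v τ (r • a) (s • b) = (r * r * s) • serre v τ a b := by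
    simp only [serre, pow_two, mul_smul_comm, smul_mul_assoc, smul_smul]
    match_scalars <;> ring
  rw [h1, hab, smul_zero]

theorem coef_self (v t : kˣ) (i : Fin m) :
    ((v ^ dotForm i i * t ^ (Omega i i - Omega i i) : kˣ) : k) = (v : k) ^ 2 := by
  simp [dotForm, Omega]

theorem coef_succ (v t : kˣ) {i j : Fin m} (h : (j : ℕ) = (i : ℕ) + 1) :
    ((v ^ dotForm i j * t ^ (Omega i j - Omega j i) : kˣ) : k) = (v : k)⁻¹ * t := by
  have h1 : i ≠ j := fun h' => by subst h'; omega
  have h2 : (i : ℕ) ≠ (i : ℕ) + 1 + 1 := by omega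
  simp [dotForm, Omega, h1, h1.symm, h, h2]

theorem coef_succ' (v t : kˣ) {i j : Fin m} (h : (j : ℕ) = (i : ℕ) + 1) :
    ((v ^ dotForm j i * t ^ (Omega j i - Omega i j) : kˣ) : k) = (v : k)⁻¹ * (t : k)⁻¹ := by
  have h1 : i ≠ j := fun h' => by subst h'; omega
  have h2 : (i : ℕ) ≠ (i : ℕ) + 1 + 1 := by omega
  simp [dotForm, Omega, h1, h1.symm, h, h2]

theorem coef_far (v t : kˣ) {i j : Fin m} (h : 1 < |(i : ℤ) - (j : ℤ)|) :
    ((v ^ dotForm i j * t ^ (Omega i j - Omega j i) : kˣ) : k) = 1 := by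
  have h1 : i ≠ j := fun h' => by subst h'; simp at h
  have h2 : (i : ℕ) ≠ (j : ℕ) + 1 := fun h' => by rw [h'] at h; simp at h
  have h3 : (j : ℕ) ≠ (i : ℕ) + 1 := fun h' => by rw [h'] at h; simp at h
  simp [dotForm, Omega, h1, h1.symm, h2, h3]

theorem dotForm_comm (i j : Fin m) : dotForm i j = dotForm j i := add_comm _ _

namespace U

variable (v t)

/-- The values of the comultiplication on the generators. -/
def comulGen : Gen m → U v t m ⊗[k] U v t m
  | E i => gen v t (E i) ⊗ₜ 1 + gen v t (K 1 i) ⊗ₜ gen v t (E i)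
  | F i => 1 ⊗ₜ gen v t (F i) + gen v t (F i) ⊗ₜ gen v t (K' 1 i)
  | K e i => gen v t (K e i) ⊗ₜ gen v t (K e i)
  | K' e i => gen v t (K' e i) ⊗ₜ gen v t (K' e i)

/-- The values of the counit on the generators. -/
def counitGen : Gen m → k
  | E _ => 0
  | F _ => 0
  | K _ _ => 1
  | K' _ _ => 1

/-- The values of the antipode on the generators. -/
def antipodeGen : Gen m → U v t m
  | E i => -(gen v t (K (-1) i) * gen v t (E i))
  | F i => -(gen v t (F i) * gen v t (K' (-1) i))
  | K e i => gen v t (K (-e) i)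
  | K' e i => gen v t (K' (-e) i)

variable {v t}

theorem K_inv_mul (i : Fin m) : gen v t (K (-1) i) * gen v t (K 1 i) = 1 := by
  simpa using rel (v := v) (t := t) (Rel.K_inv (-1) i)

theorem K'_inv_mul (i : Fin m) : gen v t (K' (-1) i) * gen v t (K' 1 i) = 1 := by
  simpa using rel (v := v) (t := t) (Rel.K'_inv (-1) i)

theorem K_mul_inv (i : Fin m) : gen v t (K 1 i) * gen v t (K (-1) i) = 1 :=
  rel (v := v) (t := t) (Rel.K_inv 1 i)

theorem K'_mul_inv (i : Fin m) : gen v t (K' 1 i) * gen v t (K' (-1) i) = 1 :=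
  rel (v := v) (t := t) (Rel.K'_inv 1 i)

theorem serreE (i j : Fin m) (h : (j : ℕ) = (i : ℕ) + 1) :
    serre v t (gen v t (E i)) (gen v t (E j)) = 0 := rel (Rel.serreE i j h)

theorem serreE' (i j : Fin m) (h : (j : ℕ) = (i : ℕ) + 1) :
    serre v t⁻¹ (gen v t (E j)) (gen v t (E i)) = 0 := by
  have h1 := rel (v := v) (t := t) (Rel.serreE' i j h)
  rw [serre_swap] at h1
  exact (smul_eq_zero_iff_right (pow_ne_zero 2 t.ne_zero)).1 h1

theorem serreF (i j : Fin m) (h : (j : ℕ) = (i : ℕ) + 1) :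
    serre v t⁻¹ (gen v t (F i)) (gen v t (F j)) = 0 := by
  have h1 := rel (v := v) (t := t) (Rel.serreF i j h)
  simpa only [serre, Units.val_inv_eq_inv_val] using h1

theorem serreF' (i j : Fin m) (h : (j : ℕ) = (i : ℕ) + 1) :
    serre v t (gen v t (F j)) (gen v t (F i)) = 0 := by
  have h1 := rel (v := v) (t := t) (Rel.serreF' i j h)
  rw [← Units.val_inv_eq_inv_val t, serre_swap, inv_inv] at h1
  exact (smul_eq_zero_iff_right (pow_ne_zero 2 (Units.ne_zero _))).1 h1

theorem K_mul_E (i j : Fin m) : gen v t (K 1 i) * gen v t (E j) =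
    ((v ^ dotForm i j * t ^ (Omega i j - Omega j i) : kˣ) : k) • (gen v t (E j) * gen v t (K 1 i)) :=
  conj_left (K_inv_mul i) (rel (Rel.KE i j))

theorem E_mul_K_inv (i j : Fin m) : gen v t (E j) * gen v t (K (-1) i) =
    ((v ^ dotForm i j * t ^ (Omega i j - Omega j i) : kˣ) : k) • (gen v t (K (-1) i) * gen v t (E j)) :=
  conj_right (K_inv_mul i) (rel (Rel.KE i j))

theorem K_mul_F (i j : Fin m) : gen v t (K 1 i) * gen v t (F j) =
    ((v ^ (-dotForm i j) * t ^ (Omega j i - Omega i j) : kˣ) : k) • (gen v t (F j) * gen v t (K 1 i)) :=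
  conj_left (K_inv_mul i) (rel (Rel.KF i j))

theorem F_mul_K_inv (i j : Fin m) : gen v t (F j) * gen v t (K (-1) i) =
    ((v ^ (-dotForm i j) * t ^ (Omega j i - Omega i j) : kˣ) : k) • (gen v t (K (-1) i) * gen v t (F j)) :=
  conj_right (K_inv_mul i) (rel (Rel.KF i j))

theorem K'_mul_E (i j : Fin m) : gen v t (K' 1 i) * gen v t (E j) =
    ((v ^ (-dotForm i j) * t ^ (Omega i j - Omega j i) : kˣ) : k) • (gen v t (E j) * gen v t (K' 1 i)) :=
  conj_left (K'_inv_mul i) (rel (Rel.K'E i j))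

theorem E_mul_K'_inv (i j : Fin m) : gen v t (E j) * gen v t (K' (-1) i) =
    ((v ^ (-dotForm i j) * t ^ (Omega i j - Omega j i) : kˣ) : k) • (gen v t (K' (-1) i) * gen v t (E j)) :=
  conj_right (K'_inv_mul i) (rel (Rel.K'E i j))

theorem K'_mul_F (i j : Fin m) : gen v t (K' 1 i) * gen v t (F j) =
    ((v ^ dotForm i j * t ^ (Omega j i - Omega i j) : kˣ) : k) • (gen v t (F j) * gen v t (K' 1 i)) :=
  conj_left (K'_inv_mul i) (rel (Rel.K'F i j))

theorem F_mul_K'_inv (i j : Fin m) : gen v t (F j) * gen v t (K' (-1) i) =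
    ((v ^ dotForm i j * t ^ (Omega j i - Omega i j) : kˣ) : k) • (gen v t (K' (-1) i) * gen v t (F j)) :=
  conj_right (K'_inv_mul i) (rel (Rel.K'F i j))

theorem comul_cross_E (i j : Fin m) :
    (gen v t (K 1 i) ⊗ₜ[k] gen v t (E i)) * (gen v t (E j) ⊗ₜ[k] 1) =
      ((v ^ dotForm i j * t ^ (Omega i j - Omega j i) : kˣ) : k) •
        ((gen v t (E j) ⊗ₜ[k] 1) * (gen v t (K 1 i) ⊗ₜ[k] gen v t (E i))) := by
  simp only [Algebra.TensorProduct.tmul_mul_tmul, mul_one, one_mul, K_mul_E,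
    TensorProduct.smul_tmul']

theorem comul_cross_F (i j : Fin m) :
    (gen v t (F i) ⊗ₜ[k] gen v t (K' 1 i)) * (1 ⊗ₜ[k] gen v t (F j)) =
      ((v ^ dotForm i j * t ^ (Omega j i - Omega i j) : kˣ) : k) •
        ((1 ⊗ₜ[k] gen v t (F j)) * (gen v t (F i) ⊗ₜ[k] gen v t (K' 1 i))) := by
  simp only [Algebra.TensorProduct.tmul_mul_tmul, mul_one, one_mul, K'_mul_F,
    TensorProduct.tmul_smul]

theorem comulGen_rel {a b : U v t m ⊗[k] U v t m} (h : Rel v t (comulGen v t) a b) : a = b := by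
  cases h with
  | KK e e' i j =>
    simp only [comulGen, Algebra.TensorProduct.tmul_mul_tmul, rel (Rel.KK e e' i j)]
  | K'K' e e' i j =>
    simp only [comulGen, Algebra.TensorProduct.tmul_mul_tmul, rel (Rel.K'K' e e' i j)]
  | KK' e e' i j =>
    simp only [comulGen, Algebra.TensorProduct.tmul_mul_tmul, rel (Rel.KK' e e' i j)]
  | K_inv e i =>
    simp only [comulGen, Algebra.TensorProduct.tmul_mul_tmul, rel (Rel.K_inv e i)]
    rfl
  | K'_inv e i =>
    simp only [comulGen, Algebra.TensorProduct.tmul_mul_tmul, rel (Rel.K'_inv e i)]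
    rfl
  | KE i j =>
    have e1 : gen v t (K 1 i) * gen v t (K 1 j) * gen v t (K (-1) i) = gen v t (K 1 j) := by
      rw [rel (Rel.KK 1 1 i j), mul_assoc, K_mul_inv, mul_one]
    simp only [comulGen, mul_add, add_mul, Algebra.TensorProduct.tmul_mul_tmul, mul_one,
      K_mul_inv, rel (Rel.KE i j), e1, smul_add, TensorProduct.tmul_smul,
      TensorProduct.smul_tmul']
  | K'E i j =>
    have e1 : gen v t (K' 1 i) * gen v t (K 1 j) * gen v t (K' (-1) i) = gen v t (K 1 j) := by
      rw [← rel (Rel.KK' 1 1 j i), mul_assoc, K'_mul_inv, mul_one]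
    simp only [comulGen, mul_add, add_mul, Algebra.TensorProduct.tmul_mul_tmul, mul_one,
      K'_mul_inv, rel (Rel.K'E i j), e1, smul_add, TensorProduct.tmul_smul,
      TensorProduct.smul_tmul']
  | KF i j =>
    have e1 : gen v t (K 1 i) * gen v t (K' 1 j) * gen v t (K (-1) i) = gen v t (K' 1 j) := by
      rw [rel (Rel.KK' 1 1 i j), mul_assoc, K_mul_inv, mul_one]
    simp only [comulGen, mul_add, add_mul, Algebra.TensorProduct.tmul_mul_tmul, mul_one,
      K_mul_inv, rel (Rel.KF i j), e1, smul_add, TensorProduct.tmul_smul,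
      TensorProduct.smul_tmul']
  | K'F i j =>
    have e1 : gen v t (K' 1 i) * gen v t (K' 1 j) * gen v t (K' (-1) i) = gen v t (K' 1 j) := by
      rw [rel (Rel.K'K' 1 1 i j), mul_assoc, K'_mul_inv, mul_one]
    simp only [comulGen, mul_add, add_mul, Algebra.TensorProduct.tmul_mul_tmul, mul_one,
      K'_mul_inv, rel (Rel.K'F i j), e1, smul_add, TensorProduct.tmul_smul,
      TensorProduct.smul_tmul']
  | EF i j =>
    have e1 := rel (v := v) (t := t) (Rel.EF i j)
    have e2 : (gen v t (K 1 i) * gen v t (F j)) ⊗ₜ[k] (gen v t (E i) * gen v t (K' 1 j)) =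
        (gen v t (F j) * gen v t (K 1 i)) ⊗ₜ[k] (gen v t (K' 1 j) * gen v t (E i)) := by
      rw [K_mul_F, K'_mul_E, dotForm_comm j i, TensorProduct.tmul_smul, TensorProduct.smul_tmul']
    have e3 : comulGen v t (E i) * comulGen v t (F j) - comulGen v t (F j) * comulGen v t (E i) =
        (gen v t (E i) * gen v t (F j) - gen v t (F j) * gen v t (E i)) ⊗ₜ[k] gen v t (K' 1 j) +
        gen v t (K 1 i) ⊗ₜ[k]
          (gen v t (E i) * gen v t (F j) - gen v t (F j) * gen v t (E i)) := by
      simp only [comulGen, mul_add, add_mul, Algebra.TensorProduct.tmul_mul_tmul, mul_one, one_mul,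
        e2, TensorProduct.tmul_sub, TensorProduct.sub_tmul]
      abel
    rw [e3, e1]
    by_cases hij : i = j
    · subst hij
      simp only [comulGen, if_true, TensorProduct.tmul_sub, TensorProduct.sub_tmul,
        TensorProduct.tmul_smul, TensorProduct.smul_tmul', smul_sub]
      abel
    · simp [hij]
  | EE i j h =>
    have h' : 1 < |(j : ℤ) - (i : ℤ)| := by rwa [abs_sub_comm]
    have e1 := comul_cross_E (v := v) (t := t) i j
    have e2 := comul_cross_E (v := v) (t := t) j i
    rw [coef_far v t h, one_smul] at e1
    rw [coef_far v t h', one_smul] at e2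
    have e3 : (gen v t (E i) ⊗ₜ[k] (1 : U v t m)) * (gen v t (E j) ⊗ₜ[k] 1) =
        (gen v t (E j) ⊗ₜ[k] 1) * (gen v t (E i) ⊗ₜ[k] 1) := by
      simp only [Algebra.TensorProduct.tmul_mul_tmul, rel (Rel.EE i j h)]
    have e4 : (gen v t (K 1 i) ⊗ₜ[k] gen v t (E i)) * (gen v t (K 1 j) ⊗ₜ[k] gen v t (E j)) =
        (gen v t (K 1 j) ⊗ₜ[k] gen v t (E j)) * (gen v t (K 1 i) ⊗ₜ[k] gen v t (E i)) := by
      simp only [Algebra.TensorProduct.tmul_mul_tmul, rel (Rel.EE i j h), rel (Rel.KK 1 1 i j)]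
    simp only [comulGen, mul_add, add_mul, e1, e2, e3, e4]
    abel
  | FF i j h =>
    have h' : 1 < |(j : ℤ) - (i : ℤ)| := by rwa [abs_sub_comm]
    have e1 := comul_cross_F (v := v) (t := t) i j
    have e2 := comul_cross_F (v := v) (t := t) j i
    rw [dotForm_comm, coef_far v t h', one_smul] at e1
    rw [dotForm_comm, coef_far v t h, one_smul] at e2
    have e3 : ((1 : U v t m) ⊗ₜ[k] gen v t (F i)) * (1 ⊗ₜ[k] gen v t (F j)) =
        (1 ⊗ₜ[k] gen v t (F j)) * (1 ⊗ₜ[k] gen v t (F i)) := by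
      simp only [Algebra.TensorProduct.tmul_mul_tmul, rel (Rel.FF i j h)]
    have e4 : (gen v t (F i) ⊗ₜ[k] gen v t (K' 1 i)) * (gen v t (F j) ⊗ₜ[k] gen v t (K' 1 j)) =
        (gen v t (F j) ⊗ₜ[k] gen v t (K' 1 j)) * (gen v t (F i) ⊗ₜ[k] gen v t (K' 1 i)) := by
      simp only [Algebra.TensorProduct.tmul_mul_tmul, rel (Rel.FF i j h), rel (Rel.K'K' 1 1 i j)]
    simp only [comulGen, mul_add, add_mul, e1, e2, e3, e4]
    abel
  | serreE i j h =>
    refine (serre_add ?_ ?_ ?_).trans ?_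
    · rw [comul_cross_E, coef_self]
    · rw [comul_cross_E, coef_succ v t h]
    · rw [comul_cross_E, coef_succ' v t h]
    · rw [serre_tmul' rfl (serreE i j h), serre_tmul (rel (Rel.KK 1 1 i j)) (serreE i j h), add_zero]
  | serreE' i j h =>
    rw [serre_swap, smul_eq_zero_iff_right (pow_ne_zero 2 t.ne_zero)]
    refine (serre_add ?_ ?_ ?_).trans ?_
    · rw [comul_cross_E, coef_self]
    · rw [comul_cross_E, coef_succ' v t h, Units.val_inv_eq_inv_val]
    · rw [comul_cross_E, coef_succ v t h, Units.val_inv_eq_inv_val, inv_inv]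
    · rw [serre_tmul' rfl (serreE' i j h), serre_tmul (rel (Rel.KK 1 1 j i)) (serreE' i j h),
        add_zero]
  | serreF i j h =>
    rw [← Units.val_inv_eq_inv_val t]
    refine (serre_add ?_ ?_ ?_).trans ?_
    · rw [comul_cross_F, coef_self]
    · rw [comul_cross_F, dotForm_comm, coef_succ' v t h, Units.val_inv_eq_inv_val]
    · rw [comul_cross_F, dotForm_comm, coef_succ v t h, Units.val_inv_eq_inv_val, inv_inv]
    · rw [serre_tmul rfl (serreF i j h), serre_tmul' (rel (Rel.K'K' 1 1 i j)) (serreF i j h),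
        add_zero]
  | serreF' i j h =>
    rw [← Units.val_inv_eq_inv_val t, serre_swap, inv_inv,
      smul_eq_zero_iff_right (pow_ne_zero 2 (Units.ne_zero _))]
    refine (serre_add ?_ ?_ ?_).trans ?_
    · rw [comul_cross_F, coef_self]
    · rw [comul_cross_F, dotForm_comm, coef_succ v t h]
    · rw [comul_cross_F, dotForm_comm, coef_succ' v t h]
    · rw [serre_tmul rfl (serreF' i j h), serre_tmul' (rel (Rel.K'K' 1 1 j i)) (serreF' i j h),
        add_zero]

theorem counitGen_rel {a b : k} (h : Rel v t (counitGen : Gen m → k) a b) : a = b := by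
  cases h <;> simp [counitGen]

theorem antipodeGen_rel {a b : (U v t m)ᵐᵒᵖ}
    (h : Rel v t (fun g => MulOpposite.op (antipodeGen v t g)) a b) : a = b := by
  cases h with
  | KK e e' i j =>
    apply MulOpposite.unop_injective
    simp only [antipodeGen, MulOpposite.unop_mul, MulOpposite.unop_op, rel (Rel.KK (-e) (-e') i j)]
  | K'K' e e' i j =>
    apply MulOpposite.unop_injective
    simp only [antipodeGen, MulOpposite.unop_mul, MulOpposite.unop_op,
      rel (Rel.K'K' (-e) (-e') i j)]
  | KK' e e' i j =>
    apply MulOpposite.unop_injective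
    simp only [antipodeGen, MulOpposite.unop_mul, MulOpposite.unop_op,
      rel (Rel.KK' (-e) (-e') i j)]
  | K_inv e i =>
    apply MulOpposite.unop_injective
    simp only [antipodeGen, MulOpposite.unop_mul, MulOpposite.unop_op, MulOpposite.unop_one,
      neg_neg, rel (Rel.K_inv e i)]
  | K'_inv e i =>
    apply MulOpposite.unop_injective
    simp only [antipodeGen, MulOpposite.unop_mul, MulOpposite.unop_op, MulOpposite.unop_one,
      neg_neg, rel (Rel.K'_inv e i)]
  | KE i j =>
    apply MulOpposite.unop_injective
    simp only [antipodeGen, MulOpposite.unop_mul, MulOpposite.unop_op, MulOpposite.unop_smul,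
      neg_neg, mul_neg, neg_mul, smul_neg]
    rw [← mul_smul_comm, ← rel (Rel.KE i j), ← mul_assoc, ← mul_assoc, ← mul_assoc,
      rel (Rel.KK 1 (-1) i j)]
    simp only [mul_assoc]
  | K'E i j =>
    apply MulOpposite.unop_injective
    simp only [antipodeGen, MulOpposite.unop_mul, MulOpposite.unop_op, MulOpposite.unop_smul,
      neg_neg, mul_neg, neg_mul, smul_neg]
    rw [← mul_smul_comm, ← rel (Rel.K'E i j), ← mul_assoc, ← mul_assoc, ← mul_assoc,
      ← rel (Rel.KK' (-1) 1 j i)]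
    simp only [mul_assoc]
  | KF i j =>
    apply MulOpposite.unop_injective
    simp only [antipodeGen, MulOpposite.unop_mul, MulOpposite.unop_op, MulOpposite.unop_smul,
      neg_neg, mul_neg, neg_mul, smul_neg]
    rw [← smul_mul_assoc, ← rel (Rel.KF i j), mul_assoc (_ * _) (gen v t (K (-1) i)),
      rel (Rel.KK' (-1) (-1) i j)]
    simp only [mul_assoc]
  | K'F i j =>
    apply MulOpposite.unop_injective
    simp only [antipodeGen, MulOpposite.unop_mul, MulOpposite.unop_op, MulOpposite.unop_smul,
      neg_neg, mul_neg, neg_mul, smul_neg]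
    rw [← smul_mul_assoc, ← rel (Rel.K'F i j), mul_assoc (_ * _) (gen v t (K' (-1) i)),
      rel (Rel.K'K' (-1) (-1) i j)]
    simp only [mul_assoc]
  | EF i j =>
    apply MulOpposite.unop_injective
    simp only [antipodeGen, MulOpposite.unop_mul, MulOpposite.unop_op, MulOpposite.unop_smul,
      MulOpposite.unop_sub, mul_neg, neg_mul, neg_neg]
    have e1 : gen v t (F j) * gen v t (K' (-1) j) * (gen v t (K (-1) i) * gen v t (E i)) =
        gen v t (K (-1) i) * (gen v t (F j) * gen v t (E i)) * gen v t (K' (-1) j) := by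
      have h1 := F_mul_K_inv (v := v) (t := t) i j
      have h2 := E_mul_K'_inv (v := v) (t := t) j i
      rw [dotForm_comm j i] at h2
      calc _ = gen v t (F j) * (gen v t (K' (-1) j) * gen v t (K (-1) i)) * gen v t (E i) := by
            simp only [mul_assoc]
        _ = gen v t (F j) * gen v t (K (-1) i) * (gen v t (K' (-1) j) * gen v t (E i)) := by
            rw [← rel (Rel.KK' (-1) (-1) i j)]; simp only [mul_assoc]
        _ = gen v t (K (-1) i) * gen v t (F j) * (gen v t (E i) * gen v t (K' (-1) j)) := by
            rw [h1, h2, smul_mul_assoc, mul_smul_comm]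
        _ = _ := by simp only [mul_assoc]
    have e2 : gen v t (K (-1) i) * gen v t (E i) * (gen v t (F j) * gen v t (K' (-1) j)) =
        gen v t (K (-1) i) * (gen v t (E i) * gen v t (F j)) * gen v t (K' (-1) j) := by
      simp only [mul_assoc]
    rw [e1, e2, ← sub_mul, ← mul_sub, ← neg_sub, rel (Rel.EF i j)]
    by_cases hij : i = j
    · subst hij
      simp only [if_true, mul_smul_comm, smul_mul_assoc, mul_sub, sub_mul,
        K_inv_mul, one_mul, mul_assoc, K'_mul_inv, mul_one, ← smul_neg, neg_sub]
    · simp [hij]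
  | EE i j h =>
    have h' : 1 < |(j : ℤ) - (i : ℤ)| := by rwa [abs_sub_comm]
    have h1 := E_mul_K_inv (v := v) (t := t) i j
    have h2 := E_mul_K_inv (v := v) (t := t) j i
    rw [coef_far v t h, one_smul] at h1
    rw [coef_far v t h', one_smul] at h2
    apply MulOpposite.unop_injective
    simp only [antipodeGen, MulOpposite.unop_mul, MulOpposite.unop_op, mul_neg, neg_mul, neg_neg]
    exact (((show Commute _ _ from rel (Rel.KK (-1) (-1) j i)).mul_right h2.symm).mul_left
      ((show Commute _ _ from h1).mul_right (rel (Rel.EE j i h')))).eq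
  | FF i j h =>
    have h' : 1 < |(j : ℤ) - (i : ℤ)| := by rwa [abs_sub_comm]
    have h1 := F_mul_K'_inv (v := v) (t := t) i j
    have h2 := F_mul_K'_inv (v := v) (t := t) j i
    rw [dotForm_comm, coef_far v t h', one_smul] at h1
    rw [dotForm_comm, coef_far v t h, one_smul] at h2
    apply MulOpposite.unop_injective
    simp only [antipodeGen, MulOpposite.unop_mul, MulOpposite.unop_op, mul_neg, neg_mul, neg_neg]
    exact (((show Commute _ _ from rel (Rel.FF j i h')).mul_right h1).mul_left
      ((show Commute _ _ from h2.symm).mul_right (rel (Rel.K'K' (-1) (-1) j i)))).eq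
  | serreE i j h =>
    refine serre_op (rel (Rel.KK (-1) (-1) i j)) ?_ ?_ ?_ (serreE i j h)
    · rw [E_mul_K_inv, coef_self]
    · rw [E_mul_K_inv, coef_succ v t h]
    · rw [E_mul_K_inv, coef_succ' v t h]
  | serreE' i j h =>
    rw [serre_swap, smul_eq_zero_iff_right (pow_ne_zero 2 t.ne_zero)]
    refine serre_op (rel (Rel.KK (-1) (-1) j i)) ?_ ?_ ?_ (serreE' i j h)
    · rw [E_mul_K_inv, coef_self]
    · rw [E_mul_K_inv, coef_succ' v t h, Units.val_inv_eq_inv_val]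
    · rw [E_mul_K_inv, coef_succ v t h, Units.val_inv_eq_inv_val, inv_inv]
  | serreF i j h =>
    rw [← Units.val_inv_eq_inv_val t]
    simp only [antipodeGen, F_mul_K'_inv, coef_self, ← smul_neg, MulOpposite.op_smul]
    refine serre_smul _ _ (serre_op (rel (Rel.K'K' (-1) (-1) i j)) ?_ ?_ ?_ (serreF i j h))
    · rw [F_mul_K'_inv, coef_self]
    · rw [F_mul_K'_inv, dotForm_comm, coef_succ' v t h, Units.val_inv_eq_inv_val]
    · rw [F_mul_K'_inv, dotForm_comm, coef_succ v t h, Units.val_inv_eq_inv_val, inv_inv]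
  | serreF' i j h =>
    rw [← Units.val_inv_eq_inv_val t, serre_swap, inv_inv,
      smul_eq_zero_iff_right (pow_ne_zero 2 (Units.ne_zero _))]
    simp only [antipodeGen, F_mul_K'_inv, coef_self, ← smul_neg, MulOpposite.op_smul]
    refine serre_smul _ _ (serre_op (rel (Rel.K'K' (-1) (-1) j i)) ?_ ?_ ?_ (serreF' i j h))
    · rw [F_mul_K'_inv, coef_self]
    · rw [F_mul_K'_inv, dotForm_comm, coef_succ v t h]
    · rw [F_mul_K'_inv, dotForm_comm, coef_succ' v t h]

end U

namespace U

instance instBialgebra (v t : kˣ) (m : ℕ) : Bialgebra k (U v t m) :=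
  Bialgebra.ofAlgHom (lift (comulGen v t) fun _ _ => comulGen_rel)
    (lift counitGen fun _ _ => counitGen_rel)
    (by
      apply hom_ext
      rintro (i | i | ⟨e, i⟩ | ⟨e, i⟩) <;>
        simp [comulGen, TensorProduct.add_tmul, TensorProduct.tmul_add, Algebra.TensorProduct.one_def,
          add_assoc])
    (by
      apply hom_ext
      rintro (i | i | ⟨e, i⟩ | ⟨e, i⟩) <;> simp [comulGen, counitGen])
    (by
      apply hom_ext
      rintro (i | i | ⟨e, i⟩ | ⟨e, i⟩) <;> simp [comulGen, counitGen])

theorem comul_gen (g : Gen m) :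
    (Coalgebra.comul (gen v t g) : U v t m ⊗[k] U v t m) = comulGen v t g :=
  lift_gen _ _ g

theorem counit_gen (g : Gen m) : (Coalgebra.counit (gen v t g) : k) = counitGen g :=
  lift_gen _ _ g

/-- The antipode of `U`. -/
def antipodeMap (v t : kˣ) (m : ℕ) : U v t m →ₗ[k] U v t m :=
  (MulOpposite.opLinearEquiv k).symm.toLinearMap ∘ₗ
    (lift (fun g => MulOpposite.op (antipodeGen v t g))
      fun _ _ => antipodeGen_rel : U v t m →ₐ[k] (U v t m)ᵐᵒᵖ).toLinearMap

theorem antipodeMap_gen (g : Gen m) : antipodeMap v t m (gen v t g) = antipodeGen v t g := by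
  simp [antipodeMap]

theorem antipodeMap_mul (x y : U v t m) :
    antipodeMap v t m (x * y) = antipodeMap v t m y * antipodeMap v t m x := by
  simp [antipodeMap]

theorem antipodeMap_algebraMap (r : k) :
    antipodeMap v t m (algebraMap k _ r) = algebraMap k _ r := by
  simp [antipodeMap]

theorem antipode_rTensor (x : U v t m) : LinearMap.mul' k (U v t m)
    ((antipodeMap v t m).rTensor (U v t m) (Coalgebra.comul x)) =
      algebraMap k (U v t m) (Coalgebra.counit x) := by
  induction x using U.induction with
  | hgen g =>
    rw [comul_gen, counit_gen]
    have h1 : antipodeMap v t m 1 = 1 := by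
      simpa using antipodeMap_algebraMap (v := v) (t := t) (m := m) 1
    rcases g with (i | i | ⟨e, i⟩ | ⟨e, i⟩)
    · simp [comulGen, counitGen, antipodeMap_gen, antipodeGen]
    · simp [comulGen, counitGen, antipodeMap_gen, antipodeGen, h1, mul_assoc, K'_inv_mul]
    · simpa [comulGen, counitGen, antipodeMap_gen, antipodeGen] using
        rel (v := v) (t := t) (Rel.K_inv (-e) i)
    · simpa [comulGen, counitGen, antipodeMap_gen, antipodeGen] using
        rel (v := v) (t := t) (Rel.K'_inv (-e) i)
  | hk r => simp [antipodeMap_algebraMap, Algebra.TensorProduct.algebraMap_apply]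
  | hadd x y hx hy => simp only [map_add, hx, hy]
  | hmul x y hx hy =>
    have key (z w : U v t m ⊗[k] U v t m) (r : k)
        (hz : LinearMap.mul' k (U v t m) ((antipodeMap v t m).rTensor (U v t m) z) =
          algebraMap k (U v t m) r) :
        LinearMap.mul' k (U v t m) ((antipodeMap v t m).rTensor (U v t m) (z * w)) =
          r • LinearMap.mul' k (U v t m) ((antipodeMap v t m).rTensor (U v t m) w) := by
      induction w with
      | zero => simp
      | add a b ha hb => simp only [mul_add, map_add, ha, hb, smul_add]
      | tmul a b =>
        have key2 : LinearMap.mul' k (U v t m)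
            ((antipodeMap v t m).rTensor (U v t m) (z * (a ⊗ₜ b))) = antipodeMap v t m a *
            LinearMap.mul' k (U v t m) ((antipodeMap v t m).rTensor (U v t m) z) * b := by
          clear hz
          induction z with
          | zero => simp
          | add c d hc hd => simp only [mul_add, add_mul, map_add, hc, hd]
          | tmul c d => simp [antipodeMap_mul, mul_assoc]
        rw [key2, hz, Algebra.algebraMap_eq_smul_one]
        simp
    rw [Bialgebra.comul_mul, key _ _ _ hx, hy, Bialgebra.counit_mul, map_mul, Algebra.smul_def]

theorem antipode_lTensor (x : U v t m) : LinearMap.mul' k (U v t m)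
    ((antipodeMap v t m).lTensor (U v t m) (Coalgebra.comul x)) =
      algebraMap k (U v t m) (Coalgebra.counit x) := by
  induction x using U.induction with
  | hgen g =>
    rw [comul_gen, counit_gen]
    have h1 : antipodeMap v t m 1 = 1 := by
      simpa using antipodeMap_algebraMap (v := v) (t := t) (m := m) 1
    rcases g with (i | i | ⟨e, i⟩ | ⟨e, i⟩)
    · simp [comulGen, counitGen, antipodeMap_gen, antipodeGen, h1, ← mul_assoc, K_mul_inv]
    · simp [comulGen, counitGen, antipodeMap_gen, antipodeGen]
    · simpa [comulGen, counitGen, antipodeMap_gen, antipodeGen] using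
        rel (v := v) (t := t) (Rel.K_inv e i)
    · simpa [comulGen, counitGen, antipodeMap_gen, antipodeGen] using
        rel (v := v) (t := t) (Rel.K'_inv e i)
  | hk r =>
    have h1 : antipodeMap v t m 1 = 1 := by
      simpa using antipodeMap_algebraMap (v := v) (t := t) (m := m) 1
    simp [Algebra.algebraMap_eq_smul_one, Algebra.TensorProduct.one_def, h1]
  | hadd x y hx hy => simp only [map_add, hx, hy]
  | hmul x y hx hy =>
    have key (z w : U v t m ⊗[k] U v t m) (r : k)
        (hw : LinearMap.mul' k (U v t m) ((antipodeMap v t m).lTensor (U v t m) w) =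
          algebraMap k (U v t m) r) :
        LinearMap.mul' k (U v t m) ((antipodeMap v t m).lTensor (U v t m) (z * w)) =
          r • LinearMap.mul' k (U v t m) ((antipodeMap v t m).lTensor (U v t m) z) := by
      induction z with
      | zero => simp
      | add a b ha hb => simp only [add_mul, map_add, ha, hb, smul_add]
      | tmul a b =>
        have key2 : LinearMap.mul' k (U v t m)
            ((antipodeMap v t m).lTensor (U v t m) ((a ⊗ₜ b) * w)) = a *
            LinearMap.mul' k (U v t m) ((antipodeMap v t m).lTensor (U v t m) w) *
              antipodeMap v t m b := by
          clear hw
          induction w with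
          | zero => simp
          | add c d hc hd => simp only [mul_add, add_mul, map_add, hc, hd]
          | tmul c d => simp [antipodeMap_mul, mul_assoc]
        rw [key2, hw, Algebra.algebraMap_eq_smul_one]
        simp
    rw [Bialgebra.comul_mul, key _ _ _ hy, hx, Bialgebra.counit_mul, mul_comm, map_mul,
      Algebra.smul_def]

instance instHopfAlgebra (v t : kˣ) (m : ℕ) : HopfAlgebra k (U v t m) :=
  { instBialgebra v t m with
    antipode := antipodeMap v t m
    mul_antipode_rTensor_comul := LinearMap.ext antipode_rTensor
    mul_antipode_lTensor_comul := LinearMap.ext antipode_lTensor }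

theorem antipode_gen (g : Gen m) :
    HopfAlgebra.antipode k (gen v t g) = antipodeGen v t g := antipodeMap_gen g

end U

/-- The set of generators `E_i`, `K_i^{±1}`. -/
def genPos (v t : kˣ) (m : ℕ) : Set (U v t m) :=
  {x | (∃ i, x = U.gen v t (E i)) ∨ ∃ e i, x = U.gen v t (K e i)}

/-- The set of generators `F_i`, `K'_i^{±1}`. -/
def genNeg (v t : kˣ) (m : ℕ) : Set (U v t m) :=
  {x | (∃ i, x = U.gen v t (F i)) ∨ ∃ e i, x = U.gen v t (K' e i)}

/-- The subalgebra `B` of `U` generated by the `E_i`, `K_i^{±1}`. -/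
def borelPos (v t : kˣ) (m : ℕ) : Subalgebra k (U v t m) := Algebra.adjoin k (genPos v t m)

/-- The subalgebra `B'` of `U` generated by the `F_i`, `K'_i^{±1}`. -/
def borelNeg (v t : kˣ) (m : ℕ) : Subalgebra k (U v t m) := Algebra.adjoin k (genNeg v t m)

theorem isHopfSubalgebra_adjoin {H : Type*} [Ring H] [HopfAlgebra k H] {s : Set H}
    (h1 : ∀ x ∈ s, (Coalgebra.comul x : H ⊗[k] H) ∈ (tensorIncl (Algebra.adjoin k s)).range)
    (h2 : ∀ x ∈ s, HopfAlgebra.antipode k x ∈ Algebra.adjoin k s) :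
    IsHopfSubalgebra (Algebra.adjoin k s) where
  comul_mem b hb := by
    have : Algebra.adjoin k s ≤ (tensorIncl (Algebra.adjoin k s)).range.comap
        (Bialgebra.comulAlgHom k H) := Algebra.adjoin_le h1
    exact this hb
  antipode_mem b hb := by
    induction hb using Algebra.adjoin_induction with
    | mem x hx => exact h2 x hx
    | algebraMap r =>
      rw [Algebra.algebraMap_eq_smul_one, map_smul, HopfAlgebra.antipode_one,
        ← Algebra.algebraMap_eq_smul_one]
      exact Subalgebra.algebraMap_mem _ r
    | add x y _ _ hx hy => rw [map_add]; exact add_mem hx hy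
    | mul x y _ _ hx hy => rw [HopfAlgebra.antipode_mul_antidistrib]; exact mul_mem hy hx

theorem tmul_mem {H : Type*} [Ring H] [HopfAlgebra k H] {B : Subalgebra k H} {a b : H}
    (ha : a ∈ B) (hb : b ∈ B) : a ⊗ₜ[k] b ∈ (tensorIncl B).range :=
  ⟨(⟨a, ha⟩ : B) ⊗ₜ (⟨b, hb⟩ : B), by simp⟩

theorem E_mem (i : Fin m) : U.gen v t (E i) ∈ borelPos v t m :=
  Algebra.subset_adjoin (Or.inl ⟨i, rfl⟩)

theorem K_mem (e : ℤˣ) (i : Fin m) : U.gen v t (K e i) ∈ borelPos v t m :=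
  Algebra.subset_adjoin (Or.inr ⟨e, i, rfl⟩)

theorem F_mem (i : Fin m) : U.gen v t (F i) ∈ borelNeg v t m :=
  Algebra.subset_adjoin (Or.inl ⟨i, rfl⟩)

theorem K'_mem (e : ℤˣ) (i : Fin m) : U.gen v t (K' e i) ∈ borelNeg v t m :=
  Algebra.subset_adjoin (Or.inr ⟨e, i, rfl⟩)

theorem borelPos_isHopf : IsHopfSubalgebra (borelPos v t m) := by
  apply isHopfSubalgebra_adjoin
  · rintro x (⟨i, rfl⟩ | ⟨e, i, rfl⟩) <;> rw [U.comul_gen]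
    · exact add_mem (tmul_mem (E_mem i) (one_mem _)) (tmul_mem (K_mem 1 i) (E_mem i))
    · exact tmul_mem (K_mem e i) (K_mem e i)
  · rintro x (⟨i, rfl⟩ | ⟨e, i, rfl⟩) <;> rw [U.antipode_gen]
    · exact neg_mem (mul_mem (K_mem _ i) (E_mem i))
    · exact K_mem _ i

theorem borelNeg_isHopf : IsHopfSubalgebra (borelNeg v t m) := by
  apply isHopfSubalgebra_adjoin
  · rintro x (⟨i, rfl⟩ | ⟨e, i, rfl⟩) <;> rw [U.comul_gen]
    · exact add_mem (tmul_mem (one_mem _) (F_mem i)) (tmul_mem (F_mem i) (K'_mem 1 i))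
    · exact tmul_mem (K'_mem e i) (K'_mem e i)
  · rintro x (⟨i, rfl⟩ | ⟨e, i, rfl⟩) <;> rw [U.antipode_gen]
    · exact neg_mem (mul_mem (F_mem i) (K'_mem _ i))
    · exact K'_mem _ i

instance borelPos.instHopfAlgebra (v t : kˣ) (m : ℕ) : HopfAlgebra k (borelPos v t m) :=
  subHopf borelPos_isHopf

instance borelNeg.instHopfAlgebra (v t : kˣ) (m : ℕ) : HopfAlgebra k (borelNeg v t m) :=
  subHopf borelNeg_isHopf

/-- Rescaling of the generators: `E_i ↦ v² E_i`, `F_i ↦ v⁻² F_i`. -/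
def U.scaleGen (v t : kˣ) : Gen m → U v t m
  | E i => ((v : k) ^ 2) • U.gen v t (E i)
  | F i => ((v : k) ^ 2)⁻¹ • U.gen v t (F i)
  | K e i => U.gen v t (K e i)
  | K' e i => U.gen v t (K' e i)

theorem U.scaleGen_rel {a b : U v t m} (h : Rel v t (U.scaleGen v t) a b) : a = b := by
  have hv := v.ne_zero
  cases h with
  | KK e e' i j => exact rel (Rel.KK e e' i j)
  | K'K' e e' i j => exact rel (Rel.K'K' e e' i j)
  | KK' e e' i j => exact rel (Rel.KK' e e' i j)
  | K_inv e i => exact rel (Rel.K_inv e i)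
  | K'_inv e i => exact rel (Rel.K'_inv e i)
  | KE i j => simp only [scaleGen, mul_smul_comm, smul_mul_assoc, rel (Rel.KE i j)]; rw [smul_comm]
  | K'E i j => simp only [scaleGen, mul_smul_comm, smul_mul_assoc, rel (Rel.K'E i j)]; rw [smul_comm]
  | KF i j => simp only [scaleGen, mul_smul_comm, smul_mul_assoc, rel (Rel.KF i j)]; rw [smul_comm]
  | K'F i j => simp only [scaleGen, mul_smul_comm, smul_mul_assoc, rel (Rel.K'F i j)]; rw [smul_comm]
  | EF i j =>
    have h1 : ((v : k) ^ 2) * ((v : k) ^ 2)⁻¹ = 1 := mul_inv_cancel₀ (pow_ne_zero 2 hv)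
    have h2 : ((v : k) ^ 2)⁻¹ * ((v : k) ^ 2) = 1 := inv_mul_cancel₀ (pow_ne_zero 2 hv)
    simp only [scaleGen, mul_smul_comm, smul_mul_assoc, smul_smul, h1, h2, one_smul,
      rel (Rel.EF i j)]
  | EE i j h => simp only [scaleGen, mul_smul_comm, smul_mul_assoc, rel (Rel.EE i j h)]
  | FF i j h => simp only [scaleGen, mul_smul_comm, smul_mul_assoc, rel (Rel.FF i j h)]
  | serreE i j h => exact serre_smul _ _ (serreE i j h)
  | serreE' i j h =>
    rw [serre_swap, smul_eq_zero_iff_right (pow_ne_zero 2 t.ne_zero)]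
    exact serre_smul _ _ (serreE' i j h)
  | serreF i j h =>
    rw [← Units.val_inv_eq_inv_val t]
    exact serre_smul _ _ (serreF i j h)
  | serreF' i j h =>
    rw [← Units.val_inv_eq_inv_val t, serre_swap, inv_inv,
      smul_eq_zero_iff_right (pow_ne_zero 2 (Units.ne_zero _))]
    exact serre_smul _ _ (serreF' i j h)

/-- The automorphism of `U` inverse to the square of the antipode. -/
def U.scale (v t : kˣ) (m : ℕ) : U v t m →ₐ[k] U v t m :=
  U.lift (U.scaleGen v t) fun _ _ => U.scaleGen_rel

theorem U.antipode_sq_gen (g : Gen m) : HopfAlgebra.antipode k (HopfAlgebra.antipode k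
    (U.scale v t m (U.gen v t g))) = U.gen v t g := by
  have hv : (v : k) ^ 2 ≠ 0 := pow_ne_zero 2 v.ne_zero
  rcases g with (i | i | ⟨e, i⟩ | ⟨e, i⟩)
  · simp only [scale, lift_gen, scaleGen, map_smul, antipode_gen, antipodeGen, map_neg,
      HopfAlgebra.antipode_mul_antidistrib, neg_neg, neg_mul, mul_assoc]
    rw [← coef_self v t i, ← mul_smul_comm, ← K_mul_E, ← mul_assoc, K_inv_mul, one_mul]
  · simp only [scale, lift_gen, scaleGen, map_smul, antipode_gen, antipodeGen, map_neg,
      HopfAlgebra.antipode_mul_antidistrib, neg_neg, mul_neg, ← mul_assoc, K'_mul_F, coef_self]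
    rw [smul_mul_assoc, smul_smul, inv_mul_cancel₀ hv, one_smul, mul_assoc, K'_mul_inv, mul_one]
  · simp [scale, antipode_gen, antipodeGen, scaleGen]
  · simp [scale, antipode_gen, antipodeGen, scaleGen]

theorem U.antipode_sq_scale (x : U v t m) : HopfAlgebra.antipode k (HopfAlgebra.antipode k
    (U.scale v t m x)) = x := by
  induction x using U.induction with
  | hgen g => exact U.antipode_sq_gen g
  | hk r => simp [Algebra.algebraMap_eq_smul_one]
  | hadd x y hx hy => simp only [map_add, hx, hy]
  | hmul x y hx hy => simp only [map_mul, HopfAlgebra.antipode_mul_antidistrib, hx, hy]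

theorem U.scale_surjective : Function.Surjective (U.scale v t m) := by
  have hv : (v : k) ^ 2 ≠ 0 := pow_ne_zero 2 v.ne_zero
  rw [← AlgHom.range_eq_top, eq_top_iff, ← U.adjoin_gen]
  refine Algebra.adjoin_le ?_
  rintro _ ⟨i | i | ⟨e, i⟩ | ⟨e, i⟩, rfl⟩
  · exact ⟨((v : k) ^ 2)⁻¹ • U.gen v t (E i), by simp [scale, scaleGen, smul_smul, hv]⟩
  · exact ⟨((v : k) ^ 2) • U.gen v t (F i), by simp [scale, scaleGen, smul_smul, hv]⟩
  · exact ⟨U.gen v t (K e i), by simp [scale, scaleGen]⟩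
  · exact ⟨U.gen v t (K' e i), by simp [scale, scaleGen]⟩

theorem U.antipode_injective :
    Function.Injective (HopfAlgebra.antipode k : U v t m →ₗ[k] U v t m) := by
  intro x y h
  obtain ⟨x, rfl⟩ := U.scale_surjective x
  obtain ⟨y, rfl⟩ := U.scale_surjective y
  have := congrArg (HopfAlgebra.antipode k) h
  rw [U.antipode_sq_scale, U.antipode_sq_scale] at this
  rw [this]

theorem U.scale_mem {x : U v t m} (hx : x ∈ borelNeg v t m) : U.scale v t m x ∈ borelNeg v t m := by
  have : borelNeg v t m ≤ (borelNeg v t m).comap (U.scale v t m) := by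
    refine Algebra.adjoin_le ?_
    rintro _ (⟨i, rfl⟩ | ⟨e, i, rfl⟩)
    · simpa [scale, scaleGen] using Subalgebra.smul_mem _ (F_mem i) _
    · simpa [scale, scaleGen] using K'_mem e i
  exact this hx

theorem borelNeg_antipode_bijective : Function.Bijective
    (HopfAlgebra.antipode k : borelNeg v t m →ₗ[k] borelNeg v t m) := by
  refine ⟨fun x y h => Subtype.ext (U.antipode_injective (congrArg Subtype.val h)), fun x => ?_⟩
  exact ⟨HopfAlgebra.antipode k ⟨U.scale v t m x, U.scale_mem x.2⟩,
    Subtype.ext (U.antipode_sq_scale (x : U v t m))⟩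

/-- The Hopf algebra `B'^coop`: opposite comultiplication, inverse antipode. -/
instance borelNegCoop.instHopfAlgebra (v t : kˣ) (m : ℕ) :
    HopfAlgebra k (Coop (borelNeg v t m)) :=
  coopHopf k (borelNeg v t m) borelNeg_antipode_bijective

/-- `E_i` as an element of `B`. -/
def eB (v t : kˣ) (i : Fin m) : borelPos v t m := ⟨U.gen v t (E i), E_mem i⟩

/-- `K_i^{±1}` as an element of `B`. -/
def kB (v t : kˣ) (e : ℤˣ) (i : Fin m) : borelPos v t m := ⟨U.gen v t (K e i), K_mem e i⟩

/-- `F_i` as an element of `B'^coop`. -/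
def fB (v t : kˣ) (i : Fin m) : Coop (borelNeg v t m) := toCoop k ⟨U.gen v t (F i), F_mem i⟩

/-- `K'_i^{±1}` as an element of `B'^coop`. -/
def k'B (v t : kˣ) (e : ℤˣ) (i : Fin m) : Coop (borelNeg v t m) :=
  toCoop k ⟨U.gen v t (K' e i), K'_mem e i⟩

/-- The prescribed values of the pairing on the generators; the values on the pairs
`(K'_i^{±1}, K_j^{±1})` with an exponent `-1` are forced by those on `(K'_i, K_j)`. -/
structure HasGeneratorValues (v t : kˣ) (m : ℕ)
    (φ : Coop (borelNeg v t m) →ₗ[k] borelPos v t m →ₗ[k] k) : Prop where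
  F_E : ∀ i j : Fin m, φ (fB v t i) (eB v t j) = if i = j then ((v : k)⁻¹ - (v : k))⁻¹ else 0
  K'_K : ∀ i j : Fin m, φ (k'B v t 1 i) (kB v t 1 j) =
    ((v ^ dotForm j i * t ^ (Omega j i - Omega i j) : kˣ) : k)
  F_K : ∀ (e : ℤˣ) (i j : Fin m), φ (fB v t i) (kB v t e j) = 0
  K'_E : ∀ (e : ℤˣ) (i j : Fin m), φ (k'B v t e i) (eB v t j) = 0

end QuantumGroup

/-- The field `ℚ(v, t)` of rational functions in two variables. -/
abbrev Qvt : Type := FractionRing (MvPolynomial (Fin 2) ℚ)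

theorem Qvt.X_ne_zero (i : Fin 2) :
    algebraMap (MvPolynomial (Fin 2) ℚ) Qvt (MvPolynomial.X i) ≠ 0 := by
  rw [Ne, IsFractionRing.to_map_eq_zero_iff]
  exact MvPolynomial.X_ne_zero i

/-- The variable `v`, as a unit of `ℚ(v, t)`. -/
def Qvt.v : Qvtˣ := Units.mk0 _ (Qvt.X_ne_zero 0)

/-- The variable `t`, as a unit of `ℚ(v, t)`. -/
def Qvt.t : Qvtˣ := Units.mk0 _ (Qvt.X_ne_zero 1)

/-- The Hopf subalgebra `B` of `U_{v,t}(sl_n)` over `ℚ(v, t)`. -/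
abbrev B (n : ℕ) : Subalgebra Qvt (U Qvt.v Qvt.t (n - 1)) := borelPos Qvt.v Qvt.t (n - 1)

/-- The Hopf subalgebra `B'` of `U_{v,t}(sl_n)` over `ℚ(v, t)`. -/
abbrev B' (n : ℕ) : Subalgebra Qvt (U Qvt.v Qvt.t (n - 1)) := borelNeg Qvt.v Qvt.t (n - 1)

end TwoParameterQuantum

end

open TwoParameterQuantum

/-! A Hopf pairing `φ` makes `h' ↦ φ h'` an algebra homomorphism from `H'` to the convolution
algebra of functionals on `H`. Since the comultiplication of `B'^coop` sends `F_i` to `F_i ⊗ 1 +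
K'_i ⊗ F_i`, the element `K'_i` has to act on `B` as a character `χ_i`, and `F_i` as a skew
derivation: `δ_i(hl) = δ_i(h) ε(l) + χ_i(h) δ_i(l)`. Existence amounts to finding such functionals
with the prescribed values and showing that they respect all relations of `B'`.

The relations of `B'` are not available: it is a subalgebra of `U`, not an algebra given by a
presentation. Symmetry replaces them. Lift the functionals `δ_i`, `χ_i` on `B` to the free algebra
on the symbols `F_i`, `K'_i^{±1}`, and likewise lift functionals `δ'_j`, `χ'_j` on `B'` to the free
algebra on `E_j`, `K_j^{±1}`. If the values at generators match, the two constructions pull back to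
the same bilinear form on the product of the free algebras (`Matching.convLift_freeProj`). One
description of this form shows that it depends on the second argument only through its image in `B`,
the other that it depends on the first only through its image in `B'`. So it descends to both sides
(`Matching.exists_isHopfPairing`), and no relation between the generators has to be checked for the
pairing.

The functionals on `B` are matrix coefficients of the vector representation of `U`. There `B` acts
by upper triangular matrices, so diagonal entries are characters and an entry next to the diagonal
is a skew derivation for two of them. A rescaling of the generators makes one of these two
characters the counit and the other one `χ_i` (`borelDer_mul`). The functionals on `B'` are obtained
by transport along the isomorphism `U_{v,t} → U_{v,t⁻¹}` that exchanges `E` with `F` and `K` with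
`K'`.

Uniqueness holds because the pairing axioms propagate values from pairs of generators, and
group-likeness forces the values that involve inverses. For the antipodes, `φ ∘ (S ⊗ 1)` and `φ ∘ (1
⊗ S)` are a left and a right convolution inverse of `φ`, hence equal. As the antipode of `B'^coop`
is `S⁻¹`, this gives `(a, b) = (S⁻¹ S a, b) = (S a, S b)`. -/

noncomputable section

namespace TwoParameterQuantum

/-! ### Functionals on a coalgebra, convolution, and duality of products with coproducts. -/

section HopfPairing

variable {k : Type*} [Field k]

/-- The extension of a family of functionals on a coalgebra to an algebra homomorphism from the free
algebra to the convolution algebra, as a bilinear form. -/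
def convLift {X H : Type*} [AddCommMonoid H] [Module k H] [Coalgebra k H] (f : X → H →ₗ[k] k) :
    FreeAlgebra k X →ₗ[k] H →ₗ[k] k :=
  (WithConv.linearEquiv k (H →ₗ[k] k)).toLinearMap ∘ₗ
    (FreeAlgebra.lift k fun x => WithConv.toConv (f x)).toLinearMap

theorem convLift_ι {X H : Type*} [AddCommMonoid H] [Module k H] [Coalgebra k H]
    (f : X → H →ₗ[k] k) (x : X) : convLift f (FreeAlgebra.ι k x) = f x := by
  simp [convLift]

theorem convLift_one {X H : Type*} [AddCommMonoid H] [Module k H] [Coalgebra k H]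
    (f : X → H →ₗ[k] k) : convLift f 1 = Coalgebra.counit := by
  ext h
  simp [convLift]

theorem tensorPairing_apply_left {H' H : Type*} [AddCommMonoid H'] [Module k H'] [AddCommMonoid H]
    [Module k H] (φ : H' →ₗ[k] H →ₗ[k] k) (a b : H') (z : H ⊗[k] H) :
    tensorPairing φ (a ⊗ₜ b) z = LinearMap.mul' k k (TensorProduct.map (φ a) (φ b) z) := by
  simp [tensorPairing]

theorem convLift_mul {X H : Type*} [AddCommMonoid H] [Module k H] [Coalgebra k H]
    (f : X → H →ₗ[k] k) (a b : FreeAlgebra k X) (h : H) :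
    convLift f (a * b) h = tensorPairing (convLift f) (a ⊗ₜ b) (Coalgebra.comul h) := by
  rw [tensorPairing_apply_left]
  simp [convLift]

section Comul

variable {A H : Type*} [Ring A] [Algebra k A] [Ring H] [Bialgebra k H] (β : A →ₗ[k] H →ₗ[k] k)

/-- This and `tensorPairing_mul_right` bring the two sides of the identity in `convLift_apply_mul`
to one common form on fourfold tensors, with the two middle factors exchanged. They are the dual of
the exchange in the product of `A ⊗ A`. -/
theorem tensorPairing_mul_left
    (hβ : ∀ a b h, β (a * b) h = tensorPairing β (a ⊗ₜ b) (Coalgebra.comul h))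
    (X Y : A ⊗[k] A) (h l : H) :
    tensorPairing β (X * Y) (h ⊗ₜ l) = tensorPairing (tensorPairing β)
      (TensorProduct.tensorTensorTensorComm k A A A A (X ⊗ₜ Y))
      (Coalgebra.comul h ⊗ₜ Coalgebra.comul l) := by
  induction X with
  | zero => simp
  | add X X' hX hX' => simp only [add_mul, map_add, TensorProduct.add_tmul, LinearMap.add_apply, *]
  | tmul p q =>
    induction Y with
    | zero => simp
    | add X X' hX hX' =>
      simp only [mul_add, map_add, TensorProduct.tmul_add, LinearMap.add_apply, *]
    | tmul p' q' =>
      simp only [Algebra.TensorProduct.tmul_mul_tmul, tensorPairing_tmul, hβ,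
        TensorProduct.tensorTensorTensorComm_tmul]

theorem tensorPairing_mul_right {x y : A} {X Y : A ⊗[k] A}
    (hx : ∀ h l, β x (h * l) = tensorPairing β X (h ⊗ₜ l))
    (hy : ∀ h l, β y (h * l) = tensorPairing β Y (h ⊗ₜ l)) (z w : H ⊗[k] H) :
    tensorPairing β (x ⊗ₜ y) (z * w) = tensorPairing (tensorPairing β)
      (TensorProduct.tensorTensorTensorComm k A A A A (X ⊗ₜ Y)) (z ⊗ₜ w) := by
  induction z with
  | zero => simp
  | add z z' hz hz' => simp only [add_mul, map_add, TensorProduct.add_tmul, *]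
  | tmul a b =>
    induction w with
    | zero => simp
    | add z z' hz hz' => simp only [mul_add, map_add, TensorProduct.tmul_add, *]
    | tmul c d =>
      rw [Algebra.TensorProduct.tmul_mul_tmul, tensorPairing_tmul, hx, hy]
      clear hx hy
      induction X with
      | zero => simp
      | add X X' hX hX' =>
        simp only [add_mul, map_add, TensorProduct.add_tmul, LinearMap.add_apply, *]
      | tmul p q =>
        induction Y with
        | zero => simp
        | add X X' hX hX' =>
          simp only [mul_add, map_add, TensorProduct.tmul_add, LinearMap.add_apply, *]
        | tmul p' q' =>
          simp only [tensorPairing_tmul, TensorProduct.tensorTensorTensorComm_tmul]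
          ring

end Comul

/-- If a lift of the comultiplication to the free algebra is dual to the multiplication on the free
generators, then it is so everywhere. -/
theorem convLift_apply_mul {X H : Type*} [Ring H] [Bialgebra k H] (f : X → H →ₗ[k] k)
    (D : FreeAlgebra k X →ₐ[k] FreeAlgebra k X ⊗[k] FreeAlgebra k X)
    (hf : ∀ x h l, f x (h * l) =
      tensorPairing (convLift f) (D (FreeAlgebra.ι k x)) (h ⊗ₜ l))
    (a : FreeAlgebra k X) (h l : H) :
    convLift f a (h * l) = tensorPairing (convLift f) (D a) (h ⊗ₜ l) := by
  induction a generalizing h l with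
  | grade0 r =>
    simp only [Algebra.algebraMap_eq_smul_one, map_smul, map_one, LinearMap.smul_apply,
      convLift_one, Algebra.TensorProduct.one_def, tensorPairing_tmul, Bialgebra.counit_mul]
  | grade1 x => rw [convLift_ι, hf]
  | mul a b ha hb =>
    -- The bialgebra axiom `Δ(hl) = Δ(h)Δ(l)` lets the hypotheses on `a` and `b` be applied factor
    -- by factor; coassociativity of `D` plays no role.
    rw [convLift_mul, Bialgebra.comul_mul, tensorPairing_mul_right _ ha hb, map_mul,
      tensorPairing_mul_left _ (convLift_mul f)]
  | add a b ha hb => simp only [map_add, LinearMap.add_apply, ha, hb]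

/-- A family of generators of a Hopf algebra, consisting of group-like elements `g s i` and of
`(1, g 1 i)`-skew-primitive elements `x i`. -/
structure SkewGenerators (k : Type*) [Field k] {I H : Type*} [Ring H] [HopfAlgebra k H] (x : I → H)
    (g : ℤˣ → I → H) : Prop where
  comul_x : ∀ i, (Coalgebra.comul (x i) : H ⊗[k] H) = x i ⊗ₜ 1 + g 1 i ⊗ₜ x i
  comul_g : ∀ s i, (Coalgebra.comul (g s i) : H ⊗[k] H) = g s i ⊗ₜ g s i
  counit_x : ∀ i, (Coalgebra.counit (x i) : k) = 0
  counit_g : ∀ s i, (Coalgebra.counit (g s i) : k) = 1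
  adjoin_eq_top : Algebra.adjoin k (Set.range x ∪ Set.range (Function.uncurry g)) = ⊤

/-- Functionals on a Hopf algebra that are dual to a family of skew-primitive and group-like
elements: characters `χ s i` and skew derivations `δ i`. -/
structure SkewFunctionals {I H : Type*} [Ring H] [HopfAlgebra k H] (δ : I → H →ₗ[k] k)
    (χ : ℤˣ → I → H →ₗ[k] k) : Prop where
  δ_one : ∀ i, δ i 1 = 0
  χ_one : ∀ s i, χ s i 1 = 1
  δ_mul : ∀ i h l, δ i (h * l) = δ i h * Coalgebra.counit l + χ 1 i h * δ i l
  χ_mul : ∀ s i h l, χ s i (h * l) = χ s i h * χ s i l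

/-! ### Descent of the pairing from free algebras, and its determination by generators. -/

section Existence

variable {I J H' H : Type*} [Ring H'] [HopfAlgebra k H'] [Ring H] [HopfAlgebra k H]

/-- The comultiplication of the free algebra on skew-primitive and group-like symbols. -/
def freeComul (k : Type*) [Field k] (I : Type*) : FreeAlgebra k (I ⊕ ℤˣ × I) →ₐ[k]
    FreeAlgebra k (I ⊕ ℤˣ × I) ⊗[k] FreeAlgebra k (I ⊕ ℤˣ × I) :=
  FreeAlgebra.lift k (Sum.elim
    (fun i => FreeAlgebra.ι k (Sum.inl i) ⊗ₜ 1 +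
      FreeAlgebra.ι k (Sum.inr (1, i)) ⊗ₜ FreeAlgebra.ι k (Sum.inl i))
    fun p => FreeAlgebra.ι k (Sum.inr p) ⊗ₜ FreeAlgebra.ι k (Sum.inr p))

/-- The projection of the free algebra onto a Hopf algebra with given generators. -/
def freeProj (k : Type*) [Field k] [Algebra k H] (x : I → H) (g : ℤˣ → I → H) :
    FreeAlgebra k (I ⊕ ℤˣ × I) →ₐ[k] H :=
  FreeAlgebra.lift k (Sum.elim x (Function.uncurry g))

theorem SkewGenerators.freeProj_surjective {x : I → H} {g : ℤˣ → I → H}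
    (hx : SkewGenerators k x g) : Function.Surjective (freeProj k x g) := by
  rw [← AlgHom.range_eq_top, eq_top_iff, ← hx.adjoin_eq_top]
  refine Algebra.adjoin_le ?_
  rintro _ (⟨i, rfl⟩ | ⟨p, rfl⟩)
  · exact ⟨FreeAlgebra.ι k (Sum.inl i), by simp [freeProj]⟩
  · exact ⟨FreeAlgebra.ι k (Sum.inr p), by simp [freeProj]⟩

theorem SkewGenerators.comul_freeProj {x : I → H} {g : ℤˣ → I → H}
    (hx : SkewGenerators k x g) (a : FreeAlgebra k (I ⊕ ℤˣ × I)) :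
    Coalgebra.comul (freeProj k x g a) =
      Algebra.TensorProduct.map (freeProj k x g) (freeProj k x g) (freeComul k I a) := by
  have : (Bialgebra.comulAlgHom k H).comp (freeProj k x g) =
      (Algebra.TensorProduct.map (freeProj k x g) (freeProj k x g)).comp (freeComul k I) := by
    ext (i | ⟨s, i⟩)
    · simp [freeProj, freeComul, hx.comul_x]
    · simp [freeProj, freeComul, hx.comul_g]
  exact DFunLike.congr_fun this a

/-- The product rules for `δ` and `χ` are exactly duality with `freeComul` on the symbols, where the
unit symbol acts as the counit. -/
theorem SkewFunctionals.convLift_apply_mul {δ : I → H →ₗ[k] k} {χ : ℤˣ → I → H →ₗ[k] k}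
    (hδ : SkewFunctionals δ χ) (a : FreeAlgebra k (I ⊕ ℤˣ × I)) (h l : H) :
    convLift (Sum.elim δ (Function.uncurry χ)) a (h * l) =
      tensorPairing (convLift (Sum.elim δ (Function.uncurry χ))) (freeComul k I a) (h ⊗ₜ l) := by
  refine TwoParameterQuantum.convLift_apply_mul _ _ ?_ a h l
  rintro (i | ⟨s, i⟩) h l
  · simp [freeComul, tensorPairing_tmul, convLift_ι, convLift_one, hδ.δ_mul]
  · simp [freeComul, tensorPairing_tmul, convLift_ι, hδ.χ_mul]

/-- The values at the generators of functionals on `H` and of functionals on `H'` agree. -/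
structure Matching (x' : I → H') (g' : ℤˣ → I → H') (x : J → H) (g : ℤˣ → J → H)
    (δ : I → H →ₗ[k] k) (χ : ℤˣ → I → H →ₗ[k] k) (δ' : J → H' →ₗ[k] k)
    (χ' : ℤˣ → J → H' →ₗ[k] k) : Prop where
  δ_x : ∀ i j, δ i (x j) = δ' j (x' i)
  δ_g : ∀ i s j, δ i (g s j) = χ' s j (x' i)
  χ_x : ∀ s i j, χ s i (x j) = δ' j (g' s i)
  χ_g : ∀ r i s j, χ r i (g s j) = χ' s j (g' r i)

variable {x' : I → H'} {g' : ℤˣ → I → H'} {x : J → H} {g : ℤˣ → J → H}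
  {δ : I → H →ₗ[k] k} {χ : ℤˣ → I → H →ₗ[k] k} {δ' : J → H' →ₗ[k] k} {χ' : ℤˣ → J → H' →ₗ[k] k}

/-- Evaluation at the group-like element `1` is multiplicative on the convolution algebra, so both
sides are algebra homomorphisms in `b` and it suffices to compare them on symbols. -/
theorem SkewFunctionals.convLift_apply_one (hx : SkewGenerators k x g)
    (hδ' : SkewFunctionals δ' χ') (b : FreeAlgebra k (J ⊕ ℤˣ × J)) :
    convLift (Sum.elim δ' (Function.uncurry χ')) b 1 = Coalgebra.counit (freeProj k x g b) := by
  induction b with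
  | grade0 r => simp [Algebra.algebraMap_eq_smul_one, convLift_one]
  | grade1 p =>
    rw [convLift_ι]
    rcases p with j | ⟨s, j⟩
    · simp [freeProj, hδ'.δ_one, hx.counit_x]
    · simp [freeProj, hδ'.χ_one, hx.counit_g]
  | mul a b ha hb =>
    rw [convLift_mul, Bialgebra.comul_one, Algebra.TensorProduct.one_def, tensorPairing_tmul, ha,
      hb, map_mul, Bialgebra.counit_mul]
  | add a b ha hb => simp only [map_add, LinearMap.add_apply, ha, hb]

/-- The case of a single symbol on the left in `Matching.convLift_freeProj`. In `b`, both sides obey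
the same product rule: on the left it is the rule for `δ` and `χ`, on the right it comes from the
comultiplication of `x' i` and `g' s i`. The two families must be treated together because the rule
for `δ i` involves `χ 1 i`. -/
theorem Matching.apply_freeProj (hx' : SkewGenerators k x' g') (hx : SkewGenerators k x g)
    (hδ : SkewFunctionals δ χ) (hδ' : SkewFunctionals δ' χ')
    (hm : Matching x' g' x g δ χ δ' χ') (b : FreeAlgebra k (J ⊕ ℤˣ × J)) :
    (∀ i, δ i (freeProj k x g b) = convLift (Sum.elim δ' (Function.uncurry χ')) b (x' i)) ∧
    ∀ s i, χ s i (freeProj k x g b) =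
      convLift (Sum.elim δ' (Function.uncurry χ')) b (g' s i) := by
  induction b with
  | grade0 r =>
    simp [Algebra.algebraMap_eq_smul_one, convLift_one, hδ.δ_one, hδ.χ_one, hx'.counit_x,
      hx'.counit_g]
  | grade1 p =>
    rw [convLift_ι]
    rcases p with j | ⟨s, j⟩
    · simp [freeProj, hm.δ_x, hm.χ_x]
    · simp [freeProj, hm.δ_g, hm.χ_g]
  | mul a b ha hb =>
    refine ⟨fun i => ?_, fun s i => ?_⟩
    · rw [map_mul, hδ.δ_mul, convLift_mul, hx'.comul_x, map_add, tensorPairing_tmul,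
        tensorPairing_tmul, ha.1, ha.2, hb.1, hδ'.convLift_apply_one hx]
    · rw [map_mul, hδ.χ_mul, convLift_mul, hx'.comul_g, tensorPairing_tmul, ha.2, hb.2]
  | add a b ha hb => simp only [map_add, LinearMap.add_apply, ha, hb, implies_true, and_self]

/-- The key symmetry. The left side sees `b` only through its image in `H`, the right side sees `a`
only through its image in `H'`; hence the common form kills the kernels of both projections. -/
theorem Matching.convLift_freeProj (hx' : SkewGenerators k x' g') (hx : SkewGenerators k x g)
    (hδ : SkewFunctionals δ χ) (hδ' : SkewFunctionals δ' χ')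
    (hm : Matching x' g' x g δ χ δ' χ') (a : FreeAlgebra k (I ⊕ ℤˣ × I))
    (b : FreeAlgebra k (J ⊕ ℤˣ × J)) :
    convLift (Sum.elim δ (Function.uncurry χ)) a (freeProj k x g b) =
      convLift (Sum.elim δ' (Function.uncurry χ')) b (freeProj k x' g' a) := by
  induction a generalizing b with
  | grade0 r =>
    simp [Algebra.algebraMap_eq_smul_one, convLift_one, hδ'.convLift_apply_one hx]
  | grade1 p =>
    rw [convLift_ι]
    rcases p with i | ⟨s, i⟩
    · simpa [freeProj] using (hm.apply_freeProj hx' hx hδ hδ' b).1 i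
    · simpa [freeProj] using (hm.apply_freeProj hx' hx hδ hδ' b).2 s i
  | mul a a' ha ha' =>
    -- A product on the left becomes a coproduct on the right in both descriptions: by definition of
    -- convolution in the first, by duality of `δ'`, `χ'` with `freeComul` in the second.
    rw [convLift_mul, hx.comul_freeProj, map_mul, hδ'.convLift_apply_mul]
    generalize freeComul k J b = z
    induction z with
    | zero => simp
    | add z z' hz hz' => simp only [map_add, LinearMap.add_apply, hz, hz']
    | tmul c d => simp only [Algebra.TensorProduct.map_tmul, tensorPairing_tmul, ha, ha']
  | add a a' ha ha' => simp only [map_add, LinearMap.add_apply, ha, ha']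

/-- Two Hopf algebras with generators and with matching functionals are in Hopf duality. -/
theorem Matching.exists_isHopfPairing (hx' : SkewGenerators k x' g') (hx : SkewGenerators k x g)
    (hδ : SkewFunctionals δ χ) (hδ' : SkewFunctionals δ' χ')
    (hm : Matching x' g' x g δ χ δ' χ') :
    ∃ φ : H' →ₗ[k] H →ₗ[k] k, IsHopfPairing φ ∧ (∀ i, φ (x' i) = δ i) ∧
      ∀ s i, φ (g' s i) = χ s i := by
  -- Any linear section serves: `hφ` describes the resulting form by the functionals on `H'`,
  -- without reference to `σ`.
  obtain ⟨σ, hσ⟩ := (freeProj k x' g').toLinearMap.exists_rightInverse_of_surjective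
    (LinearMap.range_eq_top.2 hx'.freeProj_surjective)
  have hφ (h' : H') (b : FreeAlgebra k (J ⊕ ℤˣ × J)) :
      (convLift (Sum.elim δ (Function.uncurry χ)) ∘ₗ σ) h' (freeProj k x g b) =
        convLift (Sum.elim δ' (Function.uncurry χ')) b h' := by
    rw [LinearMap.comp_apply, hm.convLift_freeProj hx' hx hδ hδ']
    exact congrArg _ (LinearMap.congr_fun hσ h')
  have hφ' (a : FreeAlgebra k (I ⊕ ℤˣ × I)) :
      (convLift (Sum.elim δ (Function.uncurry χ)) ∘ₗ σ) (freeProj k x' g' a) =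
        convLift (Sum.elim δ (Function.uncurry χ)) a := by
    ext h
    obtain ⟨b, rfl⟩ := hx.freeProj_surjective h
    rw [hφ, hm.convLift_freeProj hx' hx hδ hδ']
  -- From here on only the two descriptions matter: `hφ'` gives the axioms with `1` or a product on
  -- the left, `hφ` those with `1` or a product on the right.
  generalize convLift (Sum.elim δ (Function.uncurry χ)) ∘ₗ σ = φ at hφ hφ'
  refine ⟨φ, ⟨fun h => ?_, fun h' => ?_, fun h' h l => ?_, fun h' l' h => ?_⟩, fun i => ?_,
    fun s i => ?_⟩
  · rw [← map_one (freeProj k x' g'), hφ', convLift_one]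
  · rw [← map_one (freeProj k x g), hφ, convLift_one]
  · obtain ⟨b, rfl⟩ := hx.freeProj_surjective h
    obtain ⟨c, rfl⟩ := hx.freeProj_surjective l
    rw [← map_mul, hφ, convLift_mul]
    generalize (Coalgebra.comul h' : H' ⊗[k] H') = z
    induction z with
    | zero => simp
    | add z z' hz hz' => simp only [map_add, LinearMap.add_apply, hz, hz']
    | tmul c d => simp only [tensorPairing_tmul, hφ]
  · obtain ⟨b, rfl⟩ := hx'.freeProj_surjective h'
    obtain ⟨c, rfl⟩ := hx'.freeProj_surjective l'
    rw [← map_mul, hφ', convLift_mul, tensorPairing_apply_left, tensorPairing_apply_left, hφ', hφ']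
  · simpa [freeProj, convLift_ι] using hφ' (FreeAlgebra.ι k (Sum.inl i))
  · simpa [freeProj, convLift_ι] using hφ' (FreeAlgebra.ι k (Sum.inr (s, i)))

/-- A Hopf pairing is determined by its values at pairs of generators. -/
theorem IsHopfPairing.eq_of_generators {φ ψ : H' →ₗ[k] H →ₗ[k] k} (hφ : IsHopfPairing φ)
    (hψ : IsHopfPairing ψ) (hx' : SkewGenerators k x' g') (hx : SkewGenerators k x g)
    (hxx : ∀ i j, φ (x' i) (x j) = ψ (x' i) (x j))
    (hxg : ∀ i s j, φ (x' i) (g s j) = ψ (x' i) (g s j))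
    (hgx : ∀ s i j, φ (g' s i) (x j) = ψ (g' s i) (x j))
    (hgg : ∀ r i s j, φ (g' r i) (g s j) = ψ (g' r i) (g s j)) : φ = ψ := by
  -- The coproducts of the left generators involve only left generators and `1`, so an induction
  -- over `H` closes for both families at once; a second induction, over `H'`, then frees the left
  -- argument.
  have h1 (h : H) : (∀ i, φ (x' i) h = ψ (x' i) h) ∧ ∀ s i, φ (g' s i) h = ψ (g' s i) h := by
    have hh : h ∈ Algebra.adjoin k (Set.range x ∪ Set.range (Function.uncurry g)) := by
      rw [hx.adjoin_eq_top]; trivial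
    induction hh using Algebra.adjoin_induction with
    | mem h hh =>
      rcases hh with ⟨j, rfl⟩ | ⟨⟨s, j⟩, rfl⟩
      · exact ⟨fun i => hxx i j, fun s i => hgx s i j⟩
      · exact ⟨fun i => hxg i s j, fun r i => hgg r i s j⟩
    | algebraMap r => simp [Algebra.algebraMap_eq_smul_one, hφ.one_right, hψ.one_right]
    | add a b _ _ ha hb => simp [ha, hb]
    | mul a b _ _ ha hb =>
      simp [hφ.mul_right, hψ.mul_right, hx'.comul_x, hx'.comul_g, tensorPairing_tmul, ha, hb,
        hφ.one_left, hψ.one_left]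
  ext h' : 1
  have hh : h' ∈ Algebra.adjoin k (Set.range x' ∪ Set.range (Function.uncurry g')) := by
    rw [hx'.adjoin_eq_top]; trivial
  induction hh using Algebra.adjoin_induction with
  | mem h hh =>
    ext l
    rcases hh with ⟨j, rfl⟩ | ⟨⟨s, j⟩, rfl⟩
    · exact (h1 l).1 j
    · exact (h1 l).2 s j
  | algebraMap r =>
    ext l
    simp [Algebra.algebraMap_eq_smul_one, hφ.one_left, hψ.one_left]
  | add a b _ _ ha hb => simp [ha, hb]
  | mul a b _ _ ha hb =>
    ext l
    rw [hφ.mul_left, hψ.mul_left, tensorPairing_apply_left, tensorPairing_apply_left, ha, hb]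

end Existence

/-! ### Adjointness of the antipodes by uniqueness of convolution inverses. -/

section Antipode

variable {H' H : Type*} [Ring H'] [HopfAlgebra k H'] [Ring H] [HopfAlgebra k H]

/-- Bilinear forms on `H' × H` are multiplied as functionals on the coalgebra `H' ⊗ H`; this
expresses the product by the two separate comultiplications. -/
theorem convMul_tmul (α β : H' →ₗ[k] H →ₗ[k] k) (a : H') (b : H) :
    (WithConv.toConv (TensorProduct.lift α) * WithConv.toConv (TensorProduct.lift β)).ofConv
      (a ⊗ₜ[k] b) = LinearMap.mul' k k (TensorProduct.map₂ α β (Coalgebra.comul a)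
        (Coalgebra.comul b)) := by
  rw [LinearMap.convMul_apply, TensorProduct.comul_tmul]
  generalize (Coalgebra.comul a : H' ⊗[k] H') = z
  generalize (Coalgebra.comul b : H ⊗[k] H) = w
  induction z with
  | zero => simp
  | add z z' hz hz' => simp only [map_add, TensorProduct.add_tmul, LinearMap.add_apply, hz, hz']
  | tmul c d =>
    induction w with
    | zero => simp
    | add z z' hz hz' => simp only [map_add, TensorProduct.tmul_add, hz, hz']
    | tmul e f => simp

/-- The antipodes are adjoint with respect to a Hopf pairing. -/
theorem IsHopfPairing.antipode_left {φ : H' →ₗ[k] H →ₗ[k] k} (hφ : IsHopfPairing φ) (a : H')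
    (b : H) : φ (HopfAlgebra.antipode k a) b = φ a (HopfAlgebra.antipode k b) := by
  -- In Sweedler notation, `∑ φ(S a₁, b₁) φ(a₂, b₂) = φ(∑ S(a₁) a₂, b) = ε(a) ε(b)`.
  have h1 : WithConv.toConv (TensorProduct.lift (φ ∘ₗ HopfAlgebra.antipode k)) *
      WithConv.toConv (TensorProduct.lift φ) = 1 := by
    ext a b
    have key (z : H' ⊗[k] H') : φ (LinearMap.mul' k H' ((HopfAlgebra.antipode k).rTensor H' z)) b =
        LinearMap.mul' k k (TensorProduct.map₂ (φ ∘ₗ HopfAlgebra.antipode k) φ z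
          (Coalgebra.comul b)) := by
      induction z with
      | zero => simp
      | add z z' hz hz' => simp only [map_add, LinearMap.add_apply, hz, hz']
      | tmul c d => simp [hφ.mul_left, tensorPairing_apply_left]
    refine (convMul_tmul _ _ a b).trans ?_
    rw [← key, HopfAlgebra.mul_antipode_rTensor_comul_apply, Algebra.algebraMap_eq_smul_one]
    simp [hφ.one_left, LinearMap.convOne_def, mul_comm]
  -- Likewise `∑ φ(a₁, b₁) φ(a₂, S b₂) = φ(a, ∑ b₁ S(b₂)) = ε(a) ε(b)`.
  have h2 : WithConv.toConv (TensorProduct.lift φ) *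
      WithConv.toConv (TensorProduct.lift (φ.compl₂ (HopfAlgebra.antipode k))) = 1 := by
    ext a b
    have key (z : H ⊗[k] H) : φ a (LinearMap.mul' k H ((HopfAlgebra.antipode k).lTensor H z)) =
        LinearMap.mul' k k (TensorProduct.map₂ φ (φ.compl₂ (HopfAlgebra.antipode k))
          (Coalgebra.comul a) z) := by
      induction z with
      | zero => simp
      | add z z' hz hz' => simp only [map_add, hz, hz']
      | tmul c d =>
        rw [LinearMap.lTensor_tmul, LinearMap.mul'_apply, hφ.mul_right]
        generalize (Coalgebra.comul a : H' ⊗[k] H') = w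
        induction w with
        | zero => simp
        | add z z' hz hz' => simp only [map_add, LinearMap.add_apply, hz, hz']
        | tmul e f => simp [tensorPairing_tmul]
    refine (convMul_tmul _ _ a b).trans ?_
    rw [← key, HopfAlgebra.mul_antipode_lTensor_comul_apply, Algebra.algebraMap_eq_smul_one]
    simp [hφ.one_right, LinearMap.convOne_def, mul_comm]
  have h := congrArg WithConv.ofConv (left_inv_eq_right_inv h1 h2)
  simpa using LinearMap.congr_fun h (a ⊗ₜ b)

end Antipode

end HopfPairing

/-! ### The vector representation and its matrix coefficients on the positive Borel subalgebra. -/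

section VectorRepresentation

open Gen

variable {k : Type*} [Field k] {v t : kˣ} {m : ℕ}

/-- The eigenvalue of `K_i` at the `l`-th basis vector of the vector representation. -/
def vecWeight (v t : kˣ) (i : Fin m) (l : Fin (m + 1)) : kˣ :=
  if l = i.castSucc then v else if l = i.succ then v⁻¹ else t⁻¹

/-- Since `E_j` acts by a multiple of the matrix unit at `(j, j + 1)`, this ratio is the scalar by
which `K_i` conjugates it. The weight `t⁻¹` away from the two vectors attached to `i` produces the
power of `t` for neighbouring `i` and `j`. -/
theorem vecWeight_castSucc_div_succ (v t : kˣ) (i j : Fin m) :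
    vecWeight v t i j.castSucc * (vecWeight v t i j.succ)⁻¹ =
      v ^ dotForm i j * t ^ (Omega i j - Omega j i) := by
  rcases eq_or_ne i j with rfl | hij
  · simpa [vecWeight, dotForm, Omega, Fin.ext_iff] using (pow_two v).symm
  · have hij' : (i : ℕ) ≠ j := fun h => hij (Fin.ext h)
    by_cases h1 : (j : ℕ) = i + 1
    · have h2 : (i : ℕ) ≠ i + 1 + 1 := by omega
      simp [vecWeight, dotForm, Omega, Fin.ext_iff, h1, h2, h2.symm]
    · by_cases h2 : (i : ℕ) = j + 1
      · have h3 : (j : ℕ) ≠ j + 1 + 1 := by omega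
        simp [vecWeight, dotForm, Omega, Fin.ext_iff, h2, h3, mul_comm]
      · have h3 : (j : ℕ) + 1 ≠ i := fun h => h2 h.symm
        simp [vecWeight, dotForm, Omega, Fin.ext_iff, h1, h2, h3, hij', hij'.symm]

theorem vecWeight_succ_div_castSucc (v t : kˣ) (i j : Fin m) :
    vecWeight v t i j.succ * (vecWeight v t i j.castSucc)⁻¹ =
      v ^ (-dotForm i j) * t ^ (Omega j i - Omega i j) := by
  have h := congrArg Inv.inv (vecWeight_castSucc_div_succ v t i j)
  rwa [mul_inv, inv_inv, mul_comm, mul_inv, ← zpow_neg, ← zpow_neg, neg_sub] at h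

/-- The generators of `U` in the vector representation, where `E_i`, `K_i` and `K'_i` are rescaled
by `r i`. The coefficient of `F_i` is `1` unless `v = v⁻¹`. -/
def vecGen (v t : kˣ) (r : Fin m → kˣ) : Gen m → Matrix (Fin (m + 1)) (Fin (m + 1)) k
  | E i => Matrix.single i.castSucc i.succ (r i : k)
  | F i => Matrix.single i.succ i.castSucc (((v : k) - (v : k)⁻¹)⁻¹ * ((v : k) - (v : k)⁻¹))
  | K e i => Matrix.diagonal fun l => (((r i * vecWeight v t i l) ^ (e : ℤ) : kˣ) : k)
  | K' e i => Matrix.diagonal fun l => (((r i * vecWeight v⁻¹ t i l) ^ (e : ℤ) : kˣ) : k)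

theorem diagonal_mul_single_mul_diagonal {N : Type*} [Fintype N] [DecidableEq N] (a b : N → k)
    (p q : N) (c : k) : Matrix.diagonal a * Matrix.single p q c * Matrix.diagonal b =
      (a p * b q) • Matrix.single p q c := by
  ext x y
  rw [Matrix.mul_diagonal, Matrix.diagonal_mul, Matrix.smul_apply, Matrix.single_apply, smul_eq_mul]
  split_ifs with h
  · rw [h.1, h.2]
    ring
  · simp

theorem vecGen_conj (r : kˣ) (w : Fin (m + 1) → kˣ) (p q : Fin (m + 1)) (c : k) :
    (Matrix.diagonal fun l => (((r * w l) ^ ((1 : ℤˣ) : ℤ) : kˣ) : k)) * Matrix.single p q c *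
      (Matrix.diagonal fun l => (((r * w l) ^ ((-1 : ℤˣ) : ℤ) : kˣ) : k)) =
      ((w p * (w q)⁻¹ : kˣ) : k) • Matrix.single p q c := by
  rw [diagonal_mul_single_mul_diagonal, ← Units.val_mul]
  congr 2
  rw [Units.val_one, Units.val_neg, Units.val_one, zpow_one, zpow_neg_one, mul_inv,
    mul_mul_mul_comm, mul_inv_cancel, one_mul]

/-- The rescaling is harmless: `r i` cancels in conjugations, enters both sides of the relation for
`[E_i, F_i]` once, and the remaining relations hold because products of matrix units vanish. In each
Serre relation all three monomials are zero separately. -/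
theorem vecGen_rel {r : Fin m → kˣ} {a b : Matrix (Fin (m + 1)) (Fin (m + 1)) k}
    (h : Rel v t (vecGen v t r) a b) : a = b := by
  have hne (i : Fin m) : i.succ ≠ i.castSucc := by simp [Fin.ext_iff]
  have hsucc {i j : Fin m} (h : (j : ℕ) = (i : ℕ) + 1) : j.succ ≠ i.castSucc := by
    simp [Fin.ext_iff]; omega
  have hadj {i j : Fin m} (h : 1 < |(i : ℤ) - (j : ℤ)|) : i.succ ≠ j.castSucc := by
    intro h'
    have : (i : ℕ) + 1 = j := by simpa [Fin.ext_iff] using h'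
    rw [← this] at h
    simp at h
  cases h with
  | KK e e' i j => simp [vecGen, mul_comm]
  | K'K' e e' i j => simp [vecGen, mul_comm]
  | KK' e e' i j => simp [vecGen, mul_comm]
  | K_inv e i => simp [vecGen, -Units.val_zpow_eq_zpow_val]
  | K'_inv e i => simp [vecGen, -Units.val_zpow_eq_zpow_val]
  | KE i j =>
    simp only [vecGen]
    rw [vecGen_conj, vecWeight_castSucc_div_succ]
  | K'E i j =>
    simp only [vecGen]
    rw [vecGen_conj, vecWeight_castSucc_div_succ, inv_zpow']
  | KF i j =>
    simp only [vecGen]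
    rw [vecGen_conj, vecWeight_succ_div_castSucc]
  | K'F i j =>
    simp only [vecGen]
    rw [vecGen_conj, vecWeight_succ_div_castSucc, inv_zpow', neg_neg]
  | EF i j =>
    simp only [vecGen]
    by_cases hij : i = j
    · subst hij
      rw [Matrix.single_mul_single_same, Matrix.single_mul_single_same]
      -- `K_i` and `K'_i` agree except on the two basis vectors moved by `E_i` and `F_i`. If `v =
      -- v⁻¹`, both sides are zero because the inverse of `0` is `0`.
      ext p q
      by_cases hpq : p = q
      · subst hpq
        by_cases h1 : i.castSucc = p
        · subst h1
          simp [vecWeight, hne]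
          ring
        · by_cases h2 : i.succ = p
          · subst h2
            simp [vecWeight, hne, (hne i).symm]
            ring
          · simp [vecWeight, h1, h2, Ne.symm h1, Ne.symm h2]
      · have : ∀ l, ¬ (l = p ∧ l = q) := fun l hl => hpq (hl.1.symm.trans hl.2)
        simp [hpq, this]
    · have h1 : i.succ ≠ j.succ := by simpa using hij
      have h2 : j.castSucc ≠ i.castSucc := by simpa using Ne.symm hij
      simp [hij, Matrix.single_mul_single_of_ne _ _ _ _ h1, Matrix.single_mul_single_of_ne _ _ _ _ h2]
  | EE i j h =>
    have h' : 1 < |(j : ℤ) - (i : ℤ)| := by rwa [abs_sub_comm]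
    simp only [vecGen]
    rw [Matrix.single_mul_single_of_ne _ _ _ _ (hadj h),
      Matrix.single_mul_single_of_ne _ _ _ _ (hadj h')]
  | FF i j h =>
    have h' : 1 < |(j : ℤ) - (i : ℤ)| := by rwa [abs_sub_comm]
    simp only [vecGen]
    rw [Matrix.single_mul_single_of_ne _ _ _ _ (hadj h).symm,
      Matrix.single_mul_single_of_ne _ _ _ _ (hadj h').symm]
  | serreE i j h =>
    simp only [vecGen, pow_two, mul_assoc, Matrix.single_mul_single_of_ne _ _ _ _ (hne _),
      Matrix.single_mul_single_of_ne _ _ _ _ (hsucc h)]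
    simp
  | serreE' i j h =>
    simp only [vecGen, pow_two, Matrix.single_mul_single_of_ne _ _ _ _ (hne _),
      Matrix.single_mul_single_of_ne _ _ _ _ (hsucc h)]
    simp
  | serreF i j h =>
    simp only [vecGen, pow_two, Matrix.single_mul_single_of_ne _ _ _ _ (hne _).symm,
      Matrix.single_mul_single_of_ne _ _ _ _ (hsucc h).symm]
    simp
  | serreF' i j h =>
    simp only [vecGen, pow_two, mul_assoc, Matrix.single_mul_single_of_ne _ _ _ _ (hne _).symm,
      Matrix.single_mul_single_of_ne _ _ _ _ (hsucc h).symm]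
    simp

/-- The vector representation of `U`, twisted by a rescaling. -/
def vecRep (v t : kˣ) (r : Fin m → kˣ) :
    U v t m →ₐ[k] Matrix (Fin (m + 1)) (Fin (m + 1)) k :=
  U.lift (vecGen v t r) fun _ _ => vecGen_rel

theorem vecRep_blockTriangular (r : Fin m → kˣ) {b : U v t m} (hb : b ∈ borelPos v t m) :
    (vecRep v t r b).BlockTriangular id := by
  induction hb using Algebra.adjoin_induction with
  | mem b hb =>
    rcases hb with ⟨i, rfl⟩ | ⟨e, i, rfl⟩
    · rw [vecRep, U.lift_gen]
      exact Matrix.blockTriangular_single (by simp [Fin.le_def]) _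
    · rw [vecRep, U.lift_gen]
      exact Matrix.blockTriangular_diagonal _
  | algebraMap c =>
    rw [AlgHom.commutes, Matrix.algebraMap_eq_diagonal]
    exact Matrix.blockTriangular_diagonal _
  | add a b _ _ ha hb => rw [map_add]; exact ha.add hb
  | mul a b _ _ ha hb => rw [map_mul]; exact ha.mul hb

theorem blockTriangular_mul_apply_self {N : ℕ} {M M' : Matrix (Fin N) (Fin N) k}
    (hM : M.BlockTriangular id) (hM' : M'.BlockTriangular id) (l : Fin N) :
    (M * M') l l = M l l * M' l l := by
  rw [Matrix.mul_apply, Finset.sum_eq_single l _ (by simp)]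
  intro p _ hp
  rcases lt_or_gt_of_ne hp with h | h
  · rw [hM h, zero_mul]
  · rw [hM' h, mul_zero]

/-- No index lies strictly between `i` and `i + 1`, so triangularity leaves two terms. This is the
source of the skew Leibniz rule. -/
theorem blockTriangular_mul_apply_succ {M M' : Matrix (Fin (m + 1)) (Fin (m + 1)) k}
    (hM : M.BlockTriangular id) (hM' : M'.BlockTriangular id) (i : Fin m) :
    (M * M') i.castSucc i.succ = M i.castSucc i.castSucc * M' i.castSucc i.succ +
      M i.castSucc i.succ * M' i.succ i.succ := by
  rw [Matrix.mul_apply, Finset.sum_eq_add i.castSucc i.succ (by simp [Fin.ext_iff]) _ (by simp)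
    (by simp)]
  rintro p _ ⟨h1, h2⟩
  rcases lt_or_gt_of_ne h1 with h | h
  · rw [show M i.castSucc p = 0 from hM h, zero_mul]
  · have : i.succ < p := lt_of_le_of_ne (by simpa [Fin.le_def, Fin.lt_def] using h) h2.symm
    rw [show M' p i.succ = 0 from hM' this, mul_zero]

theorem borelPos.hom_ext {A : Type*} [Ring A] [Algebra k A] {f g : borelPos v t m →ₐ[k] A}
    (hE : ∀ i, f (eB v t i) = g (eB v t i)) (hK : ∀ e i, f (kB v t e i) = g (kB v t e i)) :
    f = g := by
  refine AlgHom.adjoin_ext ?_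
  rintro _ (⟨i, rfl⟩ | ⟨e, i, rfl⟩)
  · exact hE i
  · exact hK e i

/-- A diagonal entry of the vector representation, as a character of `B`. -/
def vecDiag (v t : kˣ) (r : Fin m → kˣ) (l : Fin (m + 1)) : borelPos v t m →ₐ[k] k :=
  AlgHom.ofLinearMap
    (Matrix.entryLinearMap k k l l ∘ₗ (vecRep v t r).toLinearMap ∘ₗ (borelPos v t m).val.toLinearMap)
    (by simp)
    (fun a b => by
      simpa using blockTriangular_mul_apply_self (vecRep_blockTriangular r a.2)
        (vecRep_blockTriangular r b.2) l)

theorem vecDiag_apply (r : Fin m → kˣ) (l : Fin (m + 1)) (b : borelPos v t m) :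
    vecDiag v t r l b = vecRep v t r b l l := rfl

theorem vecDiag_eB (r : Fin m → kˣ) (l : Fin (m + 1)) (i : Fin m) :
    vecDiag v t r l (eB v t i) = 0 := by
  have : ¬ (i.castSucc = l ∧ i.succ = l) := fun h => by
    have := h.1.trans h.2.symm
    simp [Fin.ext_iff] at this
  simp [vecDiag_apply, vecRep, eB, vecGen, this]

theorem vecDiag_kB (r : Fin m → kˣ) (l : Fin (m + 1)) (e : ℤˣ) (i : Fin m) :
    vecDiag v t r l (kB v t e i) = (((r i * vecWeight v t i l) ^ (e : ℤ) : kˣ) : k) := by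
  simp [vecDiag_apply, vecRep, kB, vecGen]

/-- The character of `B` with `E_i ↦ 0`, `K_i ↦ c i`. -/
def borelChar (v t : kˣ) (c : Fin m → kˣ) : borelPos v t m →ₐ[k] k :=
  -- Any diagonal position would do: the rescaling replaces the weight found there by `c i`.
  vecDiag v t (fun i => c i * (vecWeight v t i 0)⁻¹) 0

theorem borelChar_eB (c : Fin m → kˣ) (i : Fin m) : borelChar v t c (eB v t i) = 0 :=
  vecDiag_eB _ _ i

theorem borelChar_kB (c : Fin m → kˣ) (e : ℤˣ) (i : Fin m) :
    borelChar v t c (kB v t e i) = ((c i ^ (e : ℤ) : kˣ) : k) := by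
  rw [borelChar, vecDiag_kB, inv_mul_cancel_right]

/-- Identifies the two diagonal entries that occur in `borelDer_mul`, which come from different
positions, by their values on generators. -/
theorem vecDiag_eq_borelChar (r : Fin m → kˣ) (l : Fin (m + 1)) :
    vecDiag v t r l = borelChar v t fun i => r i * vecWeight v t i l :=
  borelPos.hom_ext (fun i => by rw [vecDiag_eB, borelChar_eB])
    fun e i => by rw [vecDiag_kB, borelChar_kB]

theorem borelChar_one (b : borelPos v t m) :
    borelChar v t (fun _ => 1) b = Coalgebra.counit b := by
  refine DFunLike.congr_fun (f := borelChar v t (fun _ => 1))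
    (g := Bialgebra.counitAlgHom k (borelPos v t m)) (borelPos.hom_ext (fun i => ?_) fun e i => ?_) b
  · rw [borelChar_eB]
    exact (U.counit_gen (E i)).symm
  · rw [borelChar_kB, one_zpow, Units.val_one]
    exact (U.counit_gen (K e i)).symm

/-- The scalar `v ^ (j · i) t ^ (⟨j, i⟩ - ⟨i, j⟩)`. -/
def commCoef (v t : kˣ) (j i : Fin m) : kˣ := v ^ dotForm j i * t ^ (Omega j i - Omega i j)

/-- The functional `b ↦ (F_i, b)` on `B`. -/
def borelDer (v t : kˣ) (i : Fin m) : borelPos v t m →ₗ[k] k :=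
  -- The rescaling below trivialises the diagonal character at position `i + 1`. It also multiplies
  -- `E_i` by the inverse weight, which the second factor of this constant undoes.
  (((v : k)⁻¹ - (v : k))⁻¹ * (vecWeight v t i i.succ : k)) •
    (Matrix.entryLinearMap k k i.castSucc i.succ ∘ₗ
      (vecRep v t fun j => (vecWeight v t j i.succ)⁻¹).toLinearMap ∘ₗ
      (borelPos v t m).val.toLinearMap)

theorem borelDer_apply (i : Fin m) (b : borelPos v t m) : borelDer v t i b =
    (((v : k)⁻¹ - (v : k))⁻¹ * (vecWeight v t i i.succ : k)) *
      vecRep v t (fun j => (vecWeight v t j i.succ)⁻¹) b i.castSucc i.succ := rfl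

theorem borelDer_eB (i j : Fin m) :
    borelDer v t i (eB v t j) = if i = j then ((v : k)⁻¹ - (v : k))⁻¹ else 0 := by
  by_cases h : i = j
  · subst h
    simp [borelDer_apply, vecRep, eB, vecGen]
  · simp [borelDer_apply, vecRep, eB, vecGen, h, Ne.symm h]

theorem borelDer_kB (i : Fin m) (e : ℤˣ) (j : Fin m) : borelDer v t i (kB v t e j) = 0 := by
  simp [borelDer_apply, vecRep, kB, vecGen, Fin.ext_iff]

/-- With this rescaling, the diagonal entry at `i + 1` is the counit and the one at `i` takes `K_j`
to the ratio of its two weights, which is `commCoef v t j i`, the prescribed value `(K'_i, K_j)`. -/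
theorem borelDer_mul (i : Fin m) (a b : borelPos v t m) :
    borelDer v t i (a * b) = borelDer v t i a * Coalgebra.counit b +
      borelChar v t (fun j => commCoef v t j i) a * borelDer v t i b := by
  have h1 : vecDiag v t (fun j => (vecWeight v t j i.succ)⁻¹) i.castSucc =
      borelChar v t fun j => commCoef v t j i := by
    rw [vecDiag_eq_borelChar]
    congr 1
    ext1 j
    rw [mul_comm, vecWeight_castSucc_div_succ, commCoef]
  have h2 : vecDiag v t (fun j => (vecWeight v t j i.succ)⁻¹) i.succ = borelChar v t fun _ => 1 := by
    rw [vecDiag_eq_borelChar]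
    congr 1
    ext1 j
    rw [inv_mul_cancel]
  rw [← borelChar_one, ← h1, ← h2, vecDiag_apply, vecDiag_apply]
  simp only [borelDer_apply, Subalgebra.coe_mul, map_mul]
  rw [blockTriangular_mul_apply_succ (vecRep_blockTriangular _ a.2) (vecRep_blockTriangular _ b.2)]
  ring

theorem borel_skewFunctionals (v t : kˣ) (m : ℕ) : SkewFunctionals (borelDer v t)
    fun (s : ℤˣ) (i : Fin m) =>
      (borelChar v t fun j => commCoef v t j i ^ (s : ℤ)).toLinearMap where
  δ_one i := by simp [borelDer_apply, Fin.ext_iff]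
  χ_one s i := by simp
  δ_mul i a b := by simpa using borelDer_mul i a b
  χ_mul s i a b := by simp

end VectorRepresentation

/-! ### Functionals on the negative Borel subalgebra, and the pairing of the two. -/

section BorelPairing

open Gen

variable {k : Type*} [Field k] {v t : kˣ} {m : ℕ}

/-- The images of the generators under the isomorphism `U_{v,t} → U_{v,t⁻¹}` that exchanges `E_i`
with `F_i` and `K_i` with `K'_i`. -/
def U.swapGen (v t : kˣ) : Gen m → U v t⁻¹ m
  | E i => U.gen v t⁻¹ (F i)
  | F i => U.gen v t⁻¹ (E i)
  | K e i => U.gen v t⁻¹ (K' e i)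
  | K' e i => U.gen v t⁻¹ (K e i)

/-- The relations for `F` and `K'` are those for `E` and `K` with `t` inverted. In the relation for
`[E_i, F_j]` both the commutator and `K_i - K'_i` change sign. -/
theorem U.swapGen_rel {a b : U v t⁻¹ m} (h : Rel v t (U.swapGen v t) a b) : a = b := by
  cases h with
  | KK e e' i j => exact rel (Rel.K'K' e e' i j)
  | K'K' e e' i j => exact rel (Rel.KK e e' i j)
  | KK' e e' i j => exact (rel (Rel.KK' e' e j i)).symm
  | K_inv e i => exact rel (Rel.K'_inv e i)
  | K'_inv e i => exact rel (Rel.K_inv e i)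
  | KE i j => simpa only [swapGen, inv_zpow', neg_sub] using rel (v := v) (t := t⁻¹) (Rel.K'F i j)
  | K'E i j => simpa only [swapGen, inv_zpow', neg_sub] using rel (v := v) (t := t⁻¹) (Rel.KF i j)
  | KF i j => simpa only [swapGen, inv_zpow', neg_sub] using rel (v := v) (t := t⁻¹) (Rel.K'E i j)
  | K'F i j => simpa only [swapGen, inv_zpow', neg_sub] using rel (v := v) (t := t⁻¹) (Rel.KE i j)
  | EF i j =>
    have h := rel (v := v) (t := t⁻¹) (Rel.EF j i)
    simp only [swapGen]
    rw [← neg_sub, h]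
    by_cases hij : i = j
    · subst hij
      rw [← smul_neg, neg_sub]
    · simp [hij, Ne.symm hij]
  | EE i j h => exact rel (Rel.FF i j h)
  | FF i j h => exact rel (Rel.EE i j h)
  | serreE i j h => simpa [swapGen] using rel (v := v) (t := t⁻¹) (Rel.serreF i j h)
  | serreE' i j h => simpa [swapGen] using rel (v := v) (t := t⁻¹) (Rel.serreF' i j h)
  | serreF i j h => simpa [swapGen] using rel (v := v) (t := t⁻¹) (Rel.serreE i j h)
  | serreF' i j h => simpa [swapGen] using rel (v := v) (t := t⁻¹) (Rel.serreE' i j h)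

/-- The isomorphism `U_{v,t} → U_{v,t⁻¹}` that exchanges `E_i` with `F_i` and `K_i` with `K'_i`. -/
def U.swap (v t : kˣ) (m : ℕ) : U v t m →ₐ[k] U v t⁻¹ m :=
  U.lift (U.swapGen v t) fun _ _ => U.swapGen_rel

theorem U.swap_mem {x : U v t m} (hx : x ∈ borelNeg v t m) :
    U.swap v t m x ∈ borelPos v t⁻¹ m := by
  have : borelNeg v t m ≤ (borelPos v t⁻¹ m).comap (U.swap v t m) := by
    refine Algebra.adjoin_le ?_
    rintro _ (⟨i, rfl⟩ | ⟨e, i, rfl⟩)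
    · simpa [swap, swapGen] using E_mem i
    · simpa [swap, swapGen] using K_mem e i
  exact this hx

/-- The restriction of `U.swap` to a map from `B'^coop` to the algebra `B` with parameters
`v, t⁻¹`. -/
def borelSwap (v t : kˣ) (m : ℕ) : Coop (borelNeg v t m) →ₐ[k] borelPos v t⁻¹ m :=
  (((U.swap v t m).comp (borelNeg v t m).val).codRestrict _ fun x => U.swap_mem x.2).comp
    (toCoop k).symm.toAlgHom

theorem borelSwap_fB (i : Fin m) : borelSwap v t m (fB v t i) = eB v t⁻¹ i :=
  Subtype.ext (U.lift_gen _ _ _)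

theorem borelSwap_k'B (e : ℤˣ) (i : Fin m) : borelSwap v t m (k'B v t e i) = kB v t⁻¹ e i :=
  Subtype.ext (U.lift_gen _ _ _)

theorem counit_swap (x : U v t m) :
    (Coalgebra.counit (U.swap v t m x) : k) = Coalgebra.counit x := by
  refine DFunLike.congr_fun (f := (Bialgebra.counitAlgHom k (U v t⁻¹ m)).comp (U.swap v t m))
    (g := Bialgebra.counitAlgHom k (U v t m)) (U.hom_ext ?_) x
  rintro (i | i | ⟨e, i⟩ | ⟨e, i⟩) <;>
    simp [U.swap, U.swapGen, U.counit_gen, U.counitGen]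

theorem counit_borelSwap (x : Coop (borelNeg v t m)) :
    (Coalgebra.counit (borelSwap v t m x) : k) = Coalgebra.counit x :=
  counit_swap (v := v) (t := t) (((toCoop k).symm x : borelNeg v t m) : U v t m)

/-- The product rules mention only multiplication and counit, so no compatibility of `f` with
comultiplications is needed to transport the functionals. -/
theorem SkewFunctionals.comp {I H H' : Type*} [Ring H] [HopfAlgebra k H] [Ring H']
    [HopfAlgebra k H'] {δ : I → H →ₗ[k] k} {χ : ℤˣ → I → H →ₗ[k] k} (hδ : SkewFunctionals δ χ)
    (f : H' →ₐ[k] H) (hf : ∀ x, (Coalgebra.counit (f x) : k) = Coalgebra.counit x) :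
    SkewFunctionals (fun i => δ i ∘ₗ f.toLinearMap) fun s i => χ s i ∘ₗ f.toLinearMap where
  δ_one i := by simp [hδ.δ_one]
  χ_one s i := by simp [hδ.χ_one]
  δ_mul i h l := by simp [hδ.δ_mul, hf]
  χ_mul s i h l := by simp [hδ.χ_mul]

theorem borelPos_skewGenerators (v t : kˣ) (m : ℕ) :
    SkewGenerators k (eB v t : Fin m → _) (kB v t) where
  comul_x i := by
    apply tensorIncl_injective
    refine (tensorIncl_subComul borelPos_isHopf _).trans ((U.comul_gen (E i)).trans ?_)
    simp [U.comulGen, eB, kB]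
  comul_g s i := by
    apply tensorIncl_injective
    refine (tensorIncl_subComul borelPos_isHopf _).trans ((U.comul_gen (K s i)).trans ?_)
    simp [U.comulGen, kB]
  counit_x i := U.counit_gen (E i)
  counit_g s i := U.counit_gen (K s i)
  adjoin_eq_top := by
    have h : Algebra.adjoin k (Subtype.val ⁻¹' genPos v t m : Set (borelPos v t m)) = ⊤ :=
      Algebra.adjoin_adjoin_coe_preimage
    rw [eq_top_iff, ← h]
    refine Algebra.adjoin_mono ?_
    rintro ⟨_, hx⟩ (⟨i, rfl⟩ | ⟨e, i, rfl⟩)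
    · exact Or.inl ⟨i, rfl⟩
    · exact Or.inr ⟨(e, i), rfl⟩

theorem comul_toCoop (x : borelNeg v t m) : (Coalgebra.comul (toCoop k x) :
    Coop (borelNeg v t m) ⊗[k] Coop (borelNeg v t m)) =
      TensorProduct.map (toCoop k).toLinearMap (toCoop k).toLinearMap
        (TensorProduct.comm k _ _ (Coalgebra.comul x)) := rfl

/-- This is where the opposite comultiplication enters: the flip gives `F_i` a coproduct of the same
shape as that of `E_i`, with `K'_i` in place of `K_i`. -/
theorem borelNeg_skewGenerators (v t : kˣ) (m : ℕ) :
    SkewGenerators k (fB v t : Fin m → _) (k'B v t) where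
  comul_x i := by
    have : (Coalgebra.comul (⟨U.gen v t (F i), F_mem i⟩ : borelNeg v t m) :
        borelNeg v t m ⊗[k] borelNeg v t m) = 1 ⊗ₜ ⟨U.gen v t (F i), F_mem i⟩ +
          ⟨U.gen v t (F i), F_mem i⟩ ⊗ₜ ⟨U.gen v t (K' 1 i), K'_mem 1 i⟩ := by
      apply tensorIncl_injective
      refine (tensorIncl_subComul borelNeg_isHopf _).trans ((U.comul_gen (F i)).trans ?_)
      simp [U.comulGen]
    rw [fB, comul_toCoop, this]
    simp [k'B]
  comul_g s i := by
    have : (Coalgebra.comul (⟨U.gen v t (K' s i), K'_mem s i⟩ : borelNeg v t m) :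
        borelNeg v t m ⊗[k] borelNeg v t m) =
          ⟨U.gen v t (K' s i), K'_mem s i⟩ ⊗ₜ ⟨U.gen v t (K' s i), K'_mem s i⟩ := by
      apply tensorIncl_injective
      refine (tensorIncl_subComul borelNeg_isHopf _).trans ((U.comul_gen (K' s i)).trans ?_)
      simp [U.comulGen]
    rw [k'B, comul_toCoop, this]
    simp
  counit_x i := U.counit_gen (F i)
  counit_g s i := U.counit_gen (K' s i)
  adjoin_eq_top := by
    have h : Algebra.adjoin k (Subtype.val ⁻¹' genNeg v t m : Set (borelNeg v t m)) = ⊤ :=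
      Algebra.adjoin_adjoin_coe_preimage
    rw [eq_top_iff, ← (AlgHom.range_eq_top (toCoop k (H := borelNeg v t m)).toAlgHom).2
      (toCoop k).surjective, ← Algebra.map_top, ← h, AlgHom.map_adjoin]
    refine Algebra.adjoin_mono ?_
    rintro _ ⟨⟨_, hx⟩, ⟨i, rfl⟩ | ⟨e, i, rfl⟩, rfl⟩
    · exact Or.inl ⟨i, rfl⟩
    · exact Or.inr ⟨(e, i), rfl⟩

theorem commCoef_inv (i j : Fin m) : commCoef v t⁻¹ i j = commCoef v t j i := by
  rw [commCoef, commCoef, inv_zpow', neg_sub, dotForm_comm]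

/-- The values on `F_i`, `E_j` are symmetric and free of `t`, the mixed ones vanish on both sides,
and on group-likes inverting `t` compensates for exchanging `i` and `j` (`commCoef_inv`). -/
theorem borel_matching (v t : kˣ) (m : ℕ) :
    Matching (fB v t : Fin m → _) (k'B v t) (eB v t) (kB v t) (borelDer v t)
      (fun (s : ℤˣ) i => (borelChar v t fun j => commCoef v t j i ^ (s : ℤ)).toLinearMap)
      (fun j => borelDer v t⁻¹ j ∘ₗ (borelSwap v t m).toLinearMap)
      fun (s : ℤˣ) j => (borelChar v t⁻¹ fun i => commCoef v t⁻¹ i j ^ (s : ℤ)).toLinearMap ∘ₗ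
        (borelSwap v t m).toLinearMap where
  δ_x i j := by simp [borelSwap_fB, borelDer_eB, eq_comm]
  δ_g i s j := by simp [borelSwap_fB, borelDer_kB, borelChar_eB]
  χ_x s i j := by simp [borelSwap_k'B, borelDer_kB, borelChar_eB]
  χ_g r i s j := by
    simp only [LinearMap.comp_apply, AlgHom.toLinearMap_apply, borelSwap_k'B, borelChar_kB,
      commCoef_inv]
    rw [← zpow_mul, ← zpow_mul, mul_comm]

theorem exists_borel_pairing (v t : kˣ) (m : ℕ) :
    ∃ φ : Coop (borelNeg v t m) →ₗ[k] borelPos v t m →ₗ[k] k,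
      IsHopfPairing φ ∧ HasGeneratorValues v t m φ := by
  obtain ⟨φ, hφ, hδ, hχ⟩ := (borel_matching v t m).exists_isHopfPairing
    (borelNeg_skewGenerators v t m) (borelPos_skewGenerators v t m) (borel_skewFunctionals v t m)
    ((borel_skewFunctionals v t⁻¹ m).comp _ counit_borelSwap)
  refine ⟨φ, hφ, ⟨fun i j => ?_, fun i j => ?_, fun e i j => ?_, fun e i j => ?_⟩⟩
  · rw [hδ, borelDer_eB]
  · rw [hχ]
    simp [borelChar_kB, commCoef]
  · rw [hδ, borelDer_kB]
  · rw [hχ, AlgHom.toLinearMap_apply, borelChar_eB]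

/-- The values of a pairing at group-like generators are determined by those at generators with
exponent `1`. -/
theorem HasGeneratorValues.k'B_kB {φ : Coop (borelNeg v t m) →ₗ[k] borelPos v t m →ₗ[k] k}
    (hφ : IsHopfPairing φ) (hv : HasGeneratorValues v t m φ) (r : ℤˣ) (i : Fin m) (s : ℤˣ)
    (j : Fin m) : φ (k'B v t r i) (kB v t s j) = ((commCoef v t j i ^ ((r : ℤ) * s) : kˣ) : k) := by
  have hpos := borelPos_skewGenerators v t m
  have hneg := borelNeg_skewGenerators v t m
  have h1 (s : ℤˣ) : φ (k'B v t 1 i) (kB v t s j) = ((commCoef v t j i ^ (s : ℤ) : kˣ) : k) := by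
    rcases Int.units_eq_one_or s with rfl | rfl
    · simp [hv.K'_K, commCoef]
    -- As `K'_i` is group-like, it pairs multiplicatively with `K_j K_j⁻¹ = 1`, so the value at
    -- `K_j⁻¹` is the inverse of the value at `K_j`. The same argument on the other side handles
    -- `K'_i⁻¹`.
    · have h := hφ.mul_right (k'B v t 1 i) (kB v t 1 j) (kB v t (-1) j)
      rw [show kB v t 1 j * kB v t (-1) j = 1 from Subtype.ext (U.K_mul_inv j), hφ.one_right,
        hneg.comul_g, hneg.counit_g, tensorPairing_tmul, hv.K'_K] at h
      rw [eq_inv_of_mul_eq_one_right h.symm]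
      simp [commCoef]
  rcases Int.units_eq_one_or r with rfl | rfl
  · simpa using h1 s
  · have h := hφ.mul_left (k'B v t 1 i) (k'B v t (-1) i) (kB v t s j)
    rw [show k'B v t 1 i * k'B v t (-1) i = 1 from
      congrArg (toCoop k (H := borelNeg v t m)) (Subtype.ext (U.K'_mul_inv i)), hφ.one_left,
      hpos.comul_g, hpos.counit_g, tensorPairing_tmul, h1] at h
    rw [eq_inv_of_mul_eq_one_right h.symm]
    simp

theorem HasGeneratorValues.unique {φ ψ : Coop (borelNeg v t m) →ₗ[k] borelPos v t m →ₗ[k] k}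
    (hφ : IsHopfPairing φ) (hφv : HasGeneratorValues v t m φ) (hψ : IsHopfPairing ψ)
    (hψv : HasGeneratorValues v t m ψ) : φ = ψ :=
  hφ.eq_of_generators hψ (borelNeg_skewGenerators v t m) (borelPos_skewGenerators v t m)
    (fun i j => by rw [hφv.F_E, hψv.F_E]) (fun i s j => by rw [hφv.F_K, hψv.F_K])
    (fun s i j => by rw [hφv.K'_E, hψv.K'_E])
    fun r i s j => by rw [hφv.k'B_kB hφ, hψv.k'B_kB hψ]

/-- The outer antipode is that of `B'^coop`, by construction the inverse of the inner one. -/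
theorem antipode_toCoop_antipode (a : borelNeg v t m) :
    HopfAlgebra.antipode k (toCoop k (HopfAlgebra.antipode k a)) = toCoop k a :=
  congrArg (toCoop k (H := borelNeg v t m)) ((LinearEquiv.ofBijective (HopfAlgebra.antipode k)
    (borelNeg_antipode_bijective (v := v) (t := t) (m := m))).symm_apply_apply a)

end BorelPairing

end TwoParameterQuantum

end

open TwoParameterQuantum
theorem mainTheorem3 (n : ℕ) :
    (∃! φ : Coop (B' n) →ₗ[Qvt] B n →ₗ[Qvt] Qvt,
      IsHopfPairing φ ∧ HasGeneratorValues Qvt.v Qvt.t (n - 1) φ) ∧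
    ∀ φ : Coop (B' n) →ₗ[Qvt] B n →ₗ[Qvt] Qvt,
      IsHopfPairing φ → HasGeneratorValues Qvt.v Qvt.t (n - 1) φ →
        ∀ (a : B' n) (b : B n),
          φ (toCoop Qvt (HopfAlgebra.antipode Qvt a)) (HopfAlgebra.antipode Qvt b) =
            φ (toCoop Qvt a) b := by
  refine ⟨?_, fun φ hφ _ a b => ?_⟩
  · obtain ⟨φ, hφ, hv⟩ := exists_borel_pairing Qvt.v Qvt.t (n - 1)
    exact ⟨φ, ⟨hφ, hv⟩, fun ψ hψ => HasGeneratorValues.unique hψ.1 hψ.2 hφ hv⟩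
  -- Adjointness moves the antipode of `b` to the left argument, where it becomes the antipode of
  -- `B'^coop` and cancels `S`.
  · rw [← hφ.antipode_left, antipode_toCoop_antipode]
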